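/- Let $k\ge 1$ be an integer, $\rho>0$, $\kappa=-1/\rho^2$, and let $B$ be the ball model of $(k+1)$-dimensional hyperbolic space of curvature $\kappa$, i.e. the Euclidean ball $\{m\in\mathbb R^{k+1}:|m|<\rho\}$ with the metric $\frac{2\rho^2|dm|}{\rho^2-|m|^2}$ and Laplacian $\triangle$. A point of Euclidean norm $\eta$ has hyperbolic distance $r(\eta)=\rho\ln\frac{\rho+\eta}{\rho-\eta}$ from the origin. For real $\lambda$, let $\varphi_\lambda(r)$ be the unique radial eigenfunction with eigenvalue $\lambda$ that equals $1$ at the origin, i.e. the unique function of the hyperbolic distance $r\in[0,\infty)$ to the origin that is (possibly complex-valued and) $C^2$ as a function on $B$, satisfies $\triangle\varphi_\lambda+\lambda\varphi_\lambda=0$ on $B$, and has $\varphi_\lambda(0)=1$; such a function exists and is unique. Theorem. Let $\lambda$ be real. Then $\varphi_\lambda(r)=0$ for some finite $r\ge 0$ if and only if $\lambda>-\kappa k^2/4$, or equivalently, if and only if $$\lambda=\frac{\alpha k-\alpha^2}{\rho^2}\quad\text{for some}\quad\alpha=\frac k2+ib,\ b\in\mathbb R,\ b\ne0.$$ If this is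 the case, then: 1. $\varphi_\lambda$ is real-valued and changes sign infinitely many times: for every $R$ it takes both a negative and a positive value on $(R,\infty)$; 2. $\varphi_\lambda(r)\to0$ as $r\to\infty$; 3. there exist positive constants $T_1,T_2,\Lambda_0$ such that $T_1<|r_2-r_1|<T_2$ for every two successive zeros $r_1,r_2$ of $\varphi_\lambda$ with $r_2>r_1>\Lambda_0$; 4. $b:=\sqrt{\frac{\lambda}{-\kappa}-\frac{k^2}{4}}>0$ and, for every $u\in\mathbb R^{k+1}$ with $|u|=\rho$ and every $\eta\in(0,\rho)$, $$\varphi_\lambda(r(\eta))=\frac1{|S(\eta)|}\int_{S(\eta)}\omega^{k/2\pm ib}(u,m)\,dS_m\quad\text{(for either sign)}$$ and $$\varphi_\lambda(r(\eta))=\frac1{|S(\eta)|}\int_{S(\eta)}\omega^{k/2}\cos\left(\sqrt{\frac{\lambda}{-\kappa}-\frac{k^2}{4}}\,\ln\omega\right)dS_m,$$ where $S(\eta)$ is the Euclidean sphere of radius $\eta$ about the origin $O$ with its surface measure $dS$ and, for $|m|=\eta$ and $\theta=\pi-\widehat{uOm}$, $$\omega=\omega(u,m)=\frac{\rho^2-\eta^2}{|u-m|^2}=\frac{\rho^2-\eta^2}{\rho^2+\eta^2+2\eta\rho\cos\theta}.$$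 -/

import Mathlib

open MeasureTheory Set Filter Topology

noncomputable section

/-- The ambient Euclidean space `ℝ^(k+1)` of the ball model of `(k+1)`-dimensional hyperbolic
space. -/
abbrev Eucl (k : ℕ) : Type := EuclideanSpace ℝ (Fin (k + 1))

/-- The conformal factor `σ(m) = 2ρ² / (ρ² - |m|²)` of the ball model: on the Euclidean ball of
radius `ρ`, the hyperbolic metric of curvature `-1/ρ²` is `σ(m)² |dm|²`. -/
def conformalFactor (k : ℕ) (ρ : ℝ) (m : Eucl k) : ℝ :=
  2 * ρ ^ 2 / (ρ ^ 2 - ‖m‖ ^ 2)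

/-- The `i`-th partial derivative. -/
def partialDeriv {k : ℕ} (i : Fin (k + 1)) (F : Eucl k → ℂ) (m : Eucl k) : ℂ :=
  fderiv ℝ F m (EuclideanSpace.single i 1)

/-- The hyperbolic Laplacian of the ball model of dimension `n = k + 1 ≥ 2`, that is, the
Laplace-Beltrami operator `(det g)^(-1/2) ∑ ∂ᵢ ((det g)^(1/2) gⁱʲ ∂ⱼ F)` of the metric
`g = σ² |dm|²`, for which `(det g)^(1/2) = σ^(k+1)` and `gⁱʲ = σ^(-2) δᵢⱼ`. -/
def hyperbolicLaplacian (k : ℕ) (ρ : ℝ) (F : Eucl k → ℂ) (m : Eucl k) : ℂ :=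
  ((conformalFactor k ρ m : ℂ) ^ (k + 1))⁻¹ *
    ∑ i : Fin (k + 1),
      partialDeriv i (fun x => (conformalFactor k ρ x : ℂ) ^ (k - 1) * partialDeriv i F x) m

/-- The hyperbolic distance `r(η)` from the origin to a point of Euclidean norm `η` in the ball
model. -/
def hyperbolicRadius (ρ η : ℝ) : ℝ :=
  ρ * Real.log ((ρ + η) / (ρ - η))

/-- `φ`, as a function of the hyperbolic distance `r ≥ 0` to the origin, is the radial
eigenfunction of the hyperbolic Laplacian with eigenvalue `μ` (in the convention
`Δ φ + μ φ = 0`) that assumes the value `1` at the origin. -/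
structure IsNormalizedRadialEigenfunction (k : ℕ) (ρ : ℝ) (μ : ℂ) (φ : ℝ → ℂ) : Prop where
  contDiffOn : ContDiffOn ℝ 2 (fun m : Eucl k => φ (hyperbolicRadius ρ ‖m‖)) (Metric.ball 0 ρ)
  eigen : ∀ m ∈ Metric.ball (0 : Eucl k) ρ,
    hyperbolicLaplacian k ρ (fun x => φ (hyperbolicRadius ρ ‖x‖)) m
      + μ * φ (hyperbolicRadius ρ ‖m‖) = 0
  at_origin : φ 0 = 1

/-- The kernel `ω(u, m) = (|u|² - |m|²) / |u - m|²`, for `|m| < |u|`. -/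
def omegaKernel {k : ℕ} (u m : Eucl k) : ℝ :=
  (‖u‖ ^ 2 - ‖m‖ ^ 2) / ‖u - m‖ ^ 2

/-- The Euclidean surface measure `dS` of the `k`-dimensional sphere `S(η)` of radius `η > 0`
about the origin: the image of the surface measure of the unit sphere under `s ↦ η s`,
multiplied by `η^k`. -/
def sphereMeasure (k : ℕ) (η : ℝ) : Measure (Eucl k) :=
  ENNReal.ofReal (η ^ k) •
    (volume : Measure (Eucl k)).toSphere.map
      (fun s : Metric.sphere (0 : Eucl k) 1 => η • (s : Eucl k))

/-- The mean value `(1 / |S(η)|) ∫_{S(η)} f dS` over the sphere of radius `η > 0`. -/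
def sphereMean {V : Type*} [NormedAddCommGroup V] [NormedSpace ℝ V] (k : ℕ) (η : ℝ)
    (f : Eucl k → V) : V :=
  ((sphereMeasure k η).real univ)⁻¹ • ∫ m, f m ∂(sphereMeasure k η)

end

/-!
Differentiating under the integral sign shows that `m ↦ ∫ ω(ρ s, m) ^ α ds`, with `s` ranging over
the unit sphere, is an eigenfunction, because `ω(u, ·) ^ α` is one with eigenvalue
`(α k - α ^ 2) / ρ ^ 2`. Rotation invariance of the sphere measure makes this average radial and
lets one exchange the average over `u` for the average over `m`.

In the hyperbolic distance `r` a radial eigenfunction solves the damped oscillator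
`y'' + P y' + λ y = 0`, `P(r) = (k / ρ) coth (r / ρ)`, whose damping is nonnegative and decreases to
`k / ρ`. An energy estimate gives uniqueness, hence real-valuedness and the integral formulas.
If `λ ≤ k ^ 2 / (4 ρ ^ 2)`, then `α` can be taken real and `φ` is the mean of a positive function.
If `λ > k ^ 2 / (4 ρ ^ 2)`, removing the damping by the substitution `y = w exp (-½ ∫ P)` leaves
`w'' + q w = 0` with `q` tending to a positive constant: comparison with trigonometric functions
yields the oscillation and the spacing of the zeros, and the energy gives the decay.
-/

section DampedODE

variable {V : Type*} [NormedAddCommGroup V] {P P' : ℝ → ℝ} {μ L : ℝ}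

/-- On `(0, ∞)`, the function `y` has derivative `z` and solves the equation
`y'' + P y' + μ y = 0` of an oscillator with time-dependent damping `P`. The first-order form keeps
the Cauchy data `(y, z)` at hand; nothing is required at the possibly singular point `0`. -/
structure SolvesDampedODE [NormedSpace ℝ V] (P : ℝ → ℝ) (μ : ℝ) (y z : ℝ → V) : Prop where
  hasDerivAt_fst : ∀ t, 0 < t → HasDerivAt y (z t) t
  hasDerivAt_snd : ∀ t, 0 < t → HasDerivAt z (-(P t • z t) - μ • y t) t

theorem tendsto_zero_of_hasDerivAt_le_neg_mul {f f' : ℝ → ℝ} {ε M : ℝ} (hε : 0 < ε)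
    (hf : ∀ t, M ≤ t → HasDerivAt f (f' t) t) (hle : ∀ t, M ≤ t → f' t ≤ -ε * f t)
    (hnonneg : ∀ t, M ≤ t → 0 ≤ f t) : Tendsto f atTop (𝓝 0) := by
  have hder : ∀ t, M ≤ t → HasDerivAt (fun t => f t * Real.exp (ε * t))
      ((f' t + ε * f t) * Real.exp (ε * t)) t := fun t ht =>
    ((hf t ht).mul (((hasDerivAt_id t).const_mul ε).exp)).congr_deriv (by simp only [id]; ring)
  have hanti : AntitoneOn (fun t => f t * Real.exp (ε * t)) (Ici M) :=
    antitoneOn_of_hasDerivWithinAt_nonpos (convex_Ici M)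
      (fun t ht => (hder t ht).continuousAt.continuousWithinAt)
      (fun t ht => (hder t (interior_subset ht)).hasDerivWithinAt)
      (fun t ht => mul_nonpos_of_nonpos_of_nonneg
        (by linarith [hle t (interior_subset ht)]) (Real.exp_pos _).le)
  have hexp : Tendsto (fun t => f M * Real.exp (ε * M) * Real.exp (-(ε * t))) atTop (𝓝 0) := by
    simpa using (Real.tendsto_exp_neg_atTop_nhds_zero.comp
      (tendsto_id.const_mul_atTop hε)).const_mul (f M * Real.exp (ε * M))
  refine tendsto_of_tendsto_of_tendsto_of_le_of_le' tendsto_const_nhds hexp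
    ((eventually_ge_atTop M).mono hnonneg) ((eventually_ge_atTop M).mono fun t ht => ?_)
  rw [Real.exp_neg, ← div_eq_mul_inv, le_div_iff₀ (Real.exp_pos _)]
  exact hanti self_mem_Ici ht ht

namespace SolvesDampedODE

section NormedSpace

variable [NormedSpace ℝ V] {y z : ℝ → V}

theorem sub {y₁ z₁ : ℝ → V} (h : SolvesDampedODE P μ y z) (h₁ : SolvesDampedODE P μ y₁ z₁) :
    SolvesDampedODE P μ (fun t => y t - y₁ t) (fun t => z t - z₁ t) where
  hasDerivAt_fst t ht := (h.hasDerivAt_fst t ht).sub (h₁.hasDerivAt_fst t ht)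
  hasDerivAt_snd t ht :=
    ((h.hasDerivAt_snd t ht).sub (h₁.hasDerivAt_snd t ht)).congr_deriv (by module)

theorem neg (h : SolvesDampedODE P μ y z) :
    SolvesDampedODE P μ (fun t => -y t) (fun t => -z t) where
  hasDerivAt_fst t ht := (h.hasDerivAt_fst t ht).neg
  hasDerivAt_snd t ht := (h.hasDerivAt_snd t ht).neg.congr_deriv (by module)

theorem map {W : Type*} [NormedAddCommGroup W] [NormedSpace ℝ W] (T : V →L[ℝ] W)
    (h : SolvesDampedODE P μ y z) : SolvesDampedODE P μ (fun t => T (y t)) (fun t => T (z t)) where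
  hasDerivAt_fst t ht := T.hasFDerivAt.comp_hasDerivAt t (h.hasDerivAt_fst t ht)
  hasDerivAt_snd t ht :=
    (T.hasFDerivAt.comp_hasDerivAt t (h.hasDerivAt_snd t ht)).congr_deriv (by simp)

end NormedSpace

section InnerProductSpace

variable [InnerProductSpace ℝ V] {y z : ℝ → V}

theorem hasDerivAt_energy_mul_exp (h : SolvesDampedODE P μ y z) (C : ℝ) {t : ℝ} (ht : 0 < t) :
    HasDerivAt (fun t => (‖y t‖ ^ 2 + ‖z t‖ ^ 2) * Real.exp (C * t))
      ((2 * (1 - μ) * inner ℝ (y t) (z t) - 2 * P t * ‖z t‖ ^ 2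
        + C * (‖y t‖ ^ 2 + ‖z t‖ ^ 2)) * Real.exp (C * t)) t := by
  refine (((h.hasDerivAt_fst t ht).norm_sq.add (h.hasDerivAt_snd t ht).norm_sq).mul
    ((hasDerivAt_id t).const_mul C).exp).congr_deriv ?_
  simp only [inner_sub_right, inner_neg_right, inner_smul_right, real_inner_self_eq_norm_sq,
    real_inner_comm (y t) (z t), Pi.add_apply, id]
  ring

theorem abs_cross_term_le (μ : ℝ) (v w : V) :
    |2 * (1 - μ) * inner ℝ v w| ≤ (1 + |μ|) * (‖v‖ ^ 2 + ‖w‖ ^ 2) := by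
  have hμ : |1 - μ| ≤ 1 + |μ| := (abs_sub 1 μ).trans_eq (by rw [abs_one])
  have hinner : 2 * |inner ℝ v w| ≤ ‖v‖ ^ 2 + ‖w‖ ^ 2 := by
    linarith [abs_real_inner_le_norm v w, two_mul_le_add_sq ‖v‖ ‖w‖]
  calc |2 * (1 - μ) * inner ℝ v w| = |1 - μ| * (2 * |inner ℝ v w|) := by
        rw [abs_mul, abs_mul, abs_two]; ring
    _ ≤ _ := by gcongr

theorem eq_zero_of_tendsto (h : SolvesDampedODE P μ y z) (hP : ∀ t, 0 < t → 0 ≤ P t)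
    (hy : Tendsto y (𝓝[>] 0) (𝓝 0)) (hz : Tendsto z (𝓝[>] 0) (𝓝 0)) {t : ℝ} (ht : 0 < t) :
    y t = 0 := by
  set C : ℝ := -(1 + |μ|)
  have hanti : AntitoneOn (fun t => (‖y t‖ ^ 2 + ‖z t‖ ^ 2) * Real.exp (C * t)) (Ioi 0) := by
    refine antitoneOn_of_hasDerivWithinAt_nonpos (convex_Ioi 0)
      (fun s hs => (h.hasDerivAt_energy_mul_exp C hs).continuousAt.continuousWithinAt)
      (fun s hs => (h.hasDerivAt_energy_mul_exp C (interior_subset hs)).hasDerivWithinAt)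
      (fun s hs => mul_nonpos_of_nonpos_of_nonneg ?_ (Real.exp_pos _).le)
    have hdamping := mul_nonneg (hP s (interior_subset hs)) (sq_nonneg ‖z s‖)
    have hcross := (le_abs_self _).trans (abs_cross_term_le μ (y s) (z s))
    linarith
  have hlim : Tendsto (fun t => (‖y t‖ ^ 2 + ‖z t‖ ^ 2) * Real.exp (C * t)) (𝓝[>] 0) (𝓝 0) := by
    have hexp : Tendsto (fun t : ℝ => Real.exp (C * t)) (𝓝[>] 0) (𝓝 (Real.exp (C * 0))) :=
      (Continuous.tendsto (by fun_prop) 0).mono_left nhdsWithin_le_nhds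
    simpa using ((hy.norm.pow 2).add (hz.norm.pow 2)).mul hexp
  have hle : (‖y t‖ ^ 2 + ‖z t‖ ^ 2) * Real.exp (C * t) ≤ 0 := by
    refine ge_of_tendsto hlim ?_
    filter_upwards [Ioo_mem_nhdsGT ht] with s hs using hanti hs.1 ht hs.2.le
  have henergy := nonpos_of_mul_nonpos_left hle (Real.exp_pos _)
  rw [← norm_eq_zero, ← sq_eq_zero_iff]
  linarith [sq_nonneg ‖y t‖, sq_nonneg ‖z t‖]

theorem eq_zero_of_le (h : SolvesDampedODE P μ y z) {a R : ℝ} (ha : 0 < a) (haR : a ≤ R)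
    (hP : BddAbove (P '' Icc a R)) (hy : y R = 0) (hz : z R = 0) : y a = 0 := by
  obtain ⟨B, hB⟩ := hP
  set C : ℝ := 1 + |μ| + 2 * |B|
  have hpos : ∀ s ∈ Icc a R, 0 < s := fun s hs => ha.trans_le hs.1
  have hmono : MonotoneOn (fun t => (‖y t‖ ^ 2 + ‖z t‖ ^ 2) * Real.exp (C * t)) (Icc a R) := by
    refine monotoneOn_of_hasDerivWithinAt_nonneg (convex_Icc a R)
      (fun s hs => (h.hasDerivAt_energy_mul_exp C (hpos s hs)).continuousAt.continuousWithinAt)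
      (fun s hs => (h.hasDerivAt_energy_mul_exp C
        (hpos s (interior_subset hs))).hasDerivWithinAt)
      (fun s hs => mul_nonneg ?_ (Real.exp_pos _).le)
    have hPs : P s ≤ |B| := (hB (mem_image_of_mem P (interior_subset hs))).trans (le_abs_self B)
    have hdamping := mul_le_mul_of_nonneg_right hPs (sq_nonneg ‖z s‖)
    have hBy := mul_nonneg (abs_nonneg B) (sq_nonneg ‖y s‖)
    have hcross := (neg_le_abs _).trans (abs_cross_term_le μ (y s) (z s))
    linarith
  have hle := hmono (left_mem_Icc.2 haR) (right_mem_Icc.2 haR) haR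
  simp only [hy, hz] at hle
  have henergy := nonpos_of_mul_nonpos_left (hle.trans_eq (by simp)) (Real.exp_pos _)
  rw [← norm_eq_zero, ← sq_eq_zero_iff]
  linarith [sq_nonneg ‖y a‖, sq_nonneg ‖z a‖]

theorem hasDerivAt_lyapunov (h : SolvesDampedODE P μ y z) (δ : ℝ) {t : ℝ} (ht : 0 < t) :
    HasDerivAt (fun t => ‖z t‖ ^ 2 + μ * ‖y t‖ ^ 2 + δ * inner ℝ (y t) (z t))
      (-((2 * P t - δ) * ‖z t‖ ^ 2 + δ * μ * ‖y t‖ ^ 2 + δ * P t * inner ℝ (y t) (z t))) t := by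
  have hy := h.hasDerivAt_fst t ht
  have hz := h.hasDerivAt_snd t ht
  refine ((hz.norm_sq.add (hy.norm_sq.const_mul μ)).add
    ((hy.inner ℝ hz).const_mul δ)).congr_deriv ?_
  simp only [inner_sub_right, inner_neg_right, inner_smul_right, real_inner_self_eq_norm_sq,
    real_inner_comm (y t) (z t)]
  ring

-- The cross term `δ ⟪v, w⟫` makes the dissipation control `‖v‖` as well as `‖w‖`.
theorem lyapunov_coercive {δ : ℝ} (hδ : δ ^ 2 ≤ μ) (v w : V) :
    μ / 2 * ‖v‖ ^ 2 ≤ ‖w‖ ^ 2 + μ * ‖v‖ ^ 2 + δ * inner ℝ v w := by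
  have hsq : ‖δ • v + (2 : ℝ) • w‖ ^ 2 = δ ^ 2 * ‖v‖ ^ 2 + 4 * (δ * inner ℝ v w) + 4 * ‖w‖ ^ 2 := by
    rw [norm_add_sq_real, real_inner_smul_left, real_inner_smul_right, norm_smul, norm_smul,
      mul_pow, mul_pow, Real.norm_eq_abs, Real.norm_eq_abs, sq_abs, sq_abs]
    ring
  have hv := mul_le_mul_of_nonneg_right hδ (sq_nonneg ‖v‖)
  have hμv := mul_nonneg ((sq_nonneg δ).trans hδ) (sq_nonneg ‖v‖)
  linarith [sq_nonneg ‖δ • v + (2 : ℝ) • w‖]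

-- The hypothesis on `p` is nonpositivity of the discriminant of the form in question.
theorem lyapunov_dissipation {δ p : ℝ} (hμ : 0 < μ) (hδ : 0 < δ)
    (hp : 3 * δ * (p - δ / 3) ^ 2 ≤ 8 * μ * (2 * p - 4 / 3 * δ)) (v w : V) :
    δ / 3 * (‖w‖ ^ 2 + μ * ‖v‖ ^ 2 + δ * inner ℝ v w) ≤
      (2 * p - δ) * ‖w‖ ^ 2 + δ * μ * ‖v‖ ^ 2 + δ * p * inner ℝ v w := by
  have hsq : ‖(4 * μ) • v + (3 * (p - δ / 3)) • w‖ ^ 2 = 16 * μ ^ 2 * ‖v‖ ^ 2 +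
      24 * μ * (p - δ / 3) * inner ℝ v w + 9 * (p - δ / 3) ^ 2 * ‖w‖ ^ 2 := by
    rw [norm_add_sq_real, real_inner_smul_left, real_inner_smul_right, norm_smul, norm_smul,
      mul_pow, mul_pow, Real.norm_eq_abs, Real.norm_eq_abs, sq_abs, sq_abs]
    ring
  have hv := mul_nonneg hδ.le (sq_nonneg ‖(4 * μ) • v + (3 * (p - δ / 3)) • w‖)
  have hw := mul_le_mul_of_nonneg_right hp (sq_nonneg ‖w‖)
  rw [hsq] at hv
  refine le_of_mul_le_mul_left ?_ (show 0 < 24 * μ by positivity)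
  linarith

theorem exists_lyapunov_weight (hL : 0 < L) (hμ : 0 < μ) :
    ∃ δ, 0 < δ ∧ δ ^ 2 ≤ μ ∧
      ∀ p ∈ Ioo (L / 2) (2 * L), 3 * δ * (p - δ / 3) ^ 2 ≤ 8 * μ * (2 * p - 4 / 3 * δ) := by
  set δ : ℝ := L * μ / (2 * (μ + L ^ 2)) with hδ
  have hδ_pos : 0 < δ := by positivity
  have hδ_mul : 2 * δ * (μ + L ^ 2) = L * μ := by rw [hδ]; field_simp
  have hδ_le : δ ≤ L / 2 := by nlinarith [mul_pos hδ_pos (pow_pos hL 2)]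
  have hδ_mul_le : 2 * δ * L ≤ μ := by nlinarith [mul_pos hδ_pos hμ]
  refine ⟨δ, hδ_pos, by nlinarith, fun p ⟨hLp, hpL⟩ => ?_⟩
  have hsq : (p - δ / 3) ^ 2 ≤ (2 * L) ^ 2 := sq_le_sq' (by linarith) (by linarith)
  linarith [mul_le_mul_of_nonneg_left hsq hδ_pos.le, mul_pos hδ_pos hμ,
    mul_pos hδ_pos (pow_pos hL 2), mul_lt_mul_of_pos_left hLp hμ]

theorem tendsto_zero (h : SolvesDampedODE P μ y z) (hP : Tendsto P atTop (𝓝 L)) (hL : 0 < L)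
    (hμ : 0 < μ) : Tendsto y atTop (𝓝 0) := by
  obtain ⟨δ, hδ_pos, hδ_sq, hδ⟩ := exists_lyapunov_weight hL hμ
  obtain ⟨N, hN⟩ := eventually_atTop.1 (hP.eventually_mem
    (Ioo_mem_nhds (half_lt_self hL) (show L < 2 * L by linarith)))
  have hdissipation : ∀ t, max N 1 ≤ t →
      -((2 * P t - δ) * ‖z t‖ ^ 2 + δ * μ * ‖y t‖ ^ 2 + δ * P t * inner ℝ (y t) (z t)) ≤
        -(δ / 3) * (‖z t‖ ^ 2 + μ * ‖y t‖ ^ 2 + δ * inner ℝ (y t) (z t)) := fun t ht => by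
    rw [neg_mul, neg_le_neg_iff]
    exact lyapunov_dissipation hμ hδ_pos (hδ _ (hN t ((le_max_left _ _).trans ht))) (y t) (z t)
  have hlyapunov := tendsto_zero_of_hasDerivAt_le_neg_mul (by positivity)
    (fun t ht => h.hasDerivAt_lyapunov δ
      (zero_lt_one.trans_le ((le_max_right N 1).trans ht))) hdissipation
    (fun t _ => (mul_nonneg (by positivity) (sq_nonneg _)).trans
      (lyapunov_coercive hδ_sq (y t) (z t)))
  have hsq : Tendsto (fun t => ‖y t‖ ^ 2) atTop (𝓝 0) := by
    refine squeeze_zero (fun t => sq_nonneg _) (fun t => ?_)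
      (by simpa using hlyapunov.const_mul (2 / μ))
    calc ‖y t‖ ^ 2 = 2 / μ * (μ / 2 * ‖y t‖ ^ 2) := by field_simp
      _ ≤ _ := by gcongr; exact lyapunov_coercive hδ_sq (y t) (z t)
  rw [tendsto_zero_iff_norm_tendsto_zero]
  simpa [Real.sqrt_sq] using hsq.sqrt

end InnerProductSpace

end SolvesDampedODE

end DampedODE

section Sturm

variable {v w Q : ℝ → ℝ} {a b q : ℝ}

theorem hasDerivAt_sturmWronskian {t : ℝ} (hv : HasDerivAt v (w t) t)
    (hw : HasDerivAt w (-(Q t * v t)) t) :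
    HasDerivAt (fun x => w x * Real.sin (q * (x - a)) - q * v x * Real.cos (q * (x - a)))
      ((q ^ 2 - Q t) * v t * Real.sin (q * (t - a))) t := by
  have harg : HasDerivAt (fun x => q * (x - a)) q t := by
    simpa using ((hasDerivAt_id t).sub_const a).const_mul q
  refine ((hw.mul harg.sin).sub ((hv.const_mul q).mul harg.cos)).congr_deriv ?_
  ring

theorem sin_mul_sub_pos (hq : 0 < q) {t : ℝ} (hat : a < t) (hta : t < a + Real.pi / q) :
    0 < Real.sin (q * (t - a)) := by
  refine Real.sin_pos_of_pos_of_lt_pi (mul_pos hq (sub_pos.2 hat)) ?_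
  rw [← lt_div_iff₀' hq]
  linarith

theorem exists_nonpos_of_sq_lt_potential (hq : 0 < q)
    (hv : ∀ t ∈ Icc a (a + Real.pi / q), HasDerivAt v (w t) t)
    (hw : ∀ t ∈ Icc a (a + Real.pi / q), HasDerivAt w (-(Q t * v t)) t)
    (hQ : ∀ t ∈ Ioo a (a + Real.pi / q), q ^ 2 < Q t) :
    ∃ t ∈ Ioo a (a + Real.pi / q), v t ≤ 0 := by
  by_contra! hpos
  have hlt : a < a + Real.pi / q := lt_add_of_pos_right a (div_pos Real.pi_pos hq)
  have hnonneg : ∀ t ∈ Icc a (a + Real.pi / q), 0 ≤ v t := by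
    rw [← closure_Ioo hlt.ne] at hv ⊢
    exact fun t ht => ContinuousWithinAt.closure_le ht continuousWithinAt_const
      (hv t ht).continuousAt.continuousWithinAt fun s hs => (hpos s hs).le
  have hanti : StrictAntiOn
      (fun x => w x * Real.sin (q * (x - a)) - q * v x * Real.cos (q * (x - a)))
      (Icc a (a + Real.pi / q)) := by
    refine strictAntiOn_of_hasDerivWithinAt_neg (convex_Icc _ _)
      (fun x hx => (hasDerivAt_sturmWronskian (hv x hx) (hw x hx)).continuousAt.continuousWithinAt)
      (fun x hx => (hasDerivAt_sturmWronskian (hv x (interior_subset hx))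
        (hw x (interior_subset hx))).hasDerivWithinAt) fun x hx => ?_
    rw [interior_Icc] at hx
    exact mul_neg_of_neg_of_pos (mul_neg_of_neg_of_pos (sub_neg.2 (hQ x hx)) (hpos x hx))
      (sin_mul_sub_pos hq hx.1 hx.2)
  have hends := hanti (left_mem_Icc.2 hlt.le) (right_mem_Icc.2 hlt.le) hlt
  simp only [add_sub_cancel_left, mul_div_cancel₀ _ hq.ne', sub_self, mul_zero, Real.sin_pi,
    Real.sin_zero, Real.cos_pi, Real.cos_zero] at hends
  linarith [mul_nonneg hq.le (hnonneg a (left_mem_Icc.2 hlt.le)),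
    mul_nonneg hq.le (hnonneg _ (right_mem_Icc.2 hlt.le))]

theorem nonpos_of_hasDerivAt_of_pos_left {f : ℝ → ℝ} {f' : ℝ} (hab : a < b)
    (hf : HasDerivAt f f' b) (hb : f b = 0) (hpos : ∀ t ∈ Ioo a b, 0 < f t) : f' ≤ 0 := by
  have hslope : Tendsto (slope f b) (𝓝[<] b) (𝓝 f') :=
    (hasDerivAt_iff_tendsto_slope.1 hf).mono_left
      (nhdsWithin_mono _ fun x (hx : x < b) => hx.ne)
  refine le_of_tendsto hslope ?_
  filter_upwards [Ioo_mem_nhdsLT hab] with t ht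
  rw [slope_def_field, hb, sub_zero]
  exact div_nonpos_of_nonneg_of_nonpos (hpos t ht).le (sub_nonpos.2 ht.2.le)

theorem pi_div_lt_arch_length_of_potential_lt_sq (hq : 0 < q) (hab : a < b)
    (hv : ∀ t ∈ Icc a b, HasDerivAt v (w t) t)
    (hw : ∀ t ∈ Icc a b, HasDerivAt w (-(Q t * v t)) t)
    (hQ : ∀ t ∈ Ioo a b, Q t < q ^ 2) (hva : v a = 0) (hvb : v b = 0)
    (hpos : ∀ t ∈ Ioo a b, 0 < v t) : Real.pi / q < b - a := by
  by_contra! hle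
  have hmono : StrictMonoOn
      (fun x => w x * Real.sin (q * (x - a)) - q * v x * Real.cos (q * (x - a)))
      (Icc a b) := by
    refine strictMonoOn_of_hasDerivWithinAt_pos (convex_Icc _ _)
      (fun x hx => (hasDerivAt_sturmWronskian (hv x hx) (hw x hx)).continuousAt.continuousWithinAt)
      (fun x hx => (hasDerivAt_sturmWronskian (hv x (interior_subset hx))
        (hw x (interior_subset hx))).hasDerivWithinAt) fun x hx => ?_
    rw [interior_Icc] at hx
    exact mul_pos (mul_pos (sub_pos.2 (hQ x hx)) (hpos x hx))
      (sin_mul_sub_pos hq hx.1 (by linarith [hx.2]))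
  have hends := hmono (left_mem_Icc.2 hab.le) (right_mem_Icc.2 hab.le) hab
  simp only [hva, hvb, sub_self, mul_zero, zero_mul, Real.sin_zero, sub_zero] at hends
  have hwb : w b ≤ 0 :=
    nonpos_of_hasDerivAt_of_pos_left hab (hv b (right_mem_Icc.2 hab.le)) hvb hpos
  have hsin : 0 ≤ Real.sin (q * (b - a)) :=
    Real.sin_nonneg_of_nonneg_of_le_pi (mul_nonneg hq.le (sub_pos.2 hab).le)
      ((le_div_iff₀' hq).1 hle)
  exact hends.not_ge (mul_nonpos_of_nonpos_of_nonneg hwb hsin)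

end Sturm

theorem forall_pos_or_forall_neg_of_ne_zero {f : ℝ → ℝ} {s : Set ℝ} (hs : IsPreconnected s)
    (hf : ContinuousOn f s) (hne : ∀ t ∈ s, f t ≠ 0) : (∀ t ∈ s, 0 < f t) ∨ ∀ t ∈ s, f t < 0 := by
  by_contra! ⟨⟨a, ha, hfa⟩, b, hb, hfb⟩
  obtain ⟨c, hc, hfc⟩ := hs.intermediate_value ha hb hf ⟨hfa, hfb⟩
  exact hne c hc hfc

namespace SolvesDampedODE

variable {P P' : ℝ → ℝ} {μ L : ℝ} {y z : ℝ → ℝ}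

/-- The factor `S = exp (½ ∫ P)` for which `S y` solves an equation without damping when `y` solves
`y'' + P y' + μ y = 0`. Any base point in `(0, ∞)` would do in place of `1`. -/
noncomputable def liouvilleFactor (P : ℝ → ℝ) (t : ℝ) : ℝ :=
  Real.exp (∫ s in 1..t, P s / 2)

/-- The potential `Q` of the Liouville normal form `v'' + Q v = 0` of `y'' + P y' + μ y = 0`, where
`P'` stands for the derivative of `P`. -/
noncomputable def liouvillePotential (P P' : ℝ → ℝ) (μ t : ℝ) : ℝ :=
  μ - P t ^ 2 / 4 - P' t / 2

theorem liouvilleFactor_pos (P : ℝ → ℝ) (t : ℝ) : 0 < liouvilleFactor P t := Real.exp_pos _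

theorem hasDerivAt_liouvilleFactor (hP : ContinuousOn P (Ioi 0)) {t : ℝ} (ht : 0 < t) :
    HasDerivAt (liouvilleFactor P) (liouvilleFactor P t * (P t / 2)) t := by
  have hcont : ContinuousOn (fun s => P s / 2) (Ioi 0) := hP.div_const 2
  have hint : IntervalIntegrable (fun s => P s / 2) volume 1 t :=
    (hcont.mono (ordConnected_Ioi.uIcc_subset zero_lt_one ht)).intervalIntegrable
  exact (intervalIntegral.integral_hasDerivAt_right hint
    (hcont.stronglyMeasurableAtFilter isOpen_Ioi t ht) (hcont.continuousAt (Ioi_mem_nhds ht))).exp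

theorem hasDerivAt_liouville_fst (h : SolvesDampedODE P μ y z) (hP : ContinuousOn P (Ioi 0))
    {t : ℝ} (ht : 0 < t) :
    HasDerivAt (fun t => liouvilleFactor P t * y t)
      (liouvilleFactor P t * (z t + P t / 2 * y t)) t := by
  refine ((hasDerivAt_liouvilleFactor hP ht).mul (h.hasDerivAt_fst t ht)).congr_deriv ?_
  ring

theorem hasDerivAt_liouville_snd (h : SolvesDampedODE P μ y z)
    (hP : ∀ t, 0 < t → HasDerivAt P (P' t) t) {t : ℝ} (ht : 0 < t) :
    HasDerivAt (fun t => liouvilleFactor P t * (z t + P t / 2 * y t))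
      (-(liouvillePotential P P' μ t * (liouvilleFactor P t * y t))) t := by
  have hcont : ContinuousOn P (Ioi 0) := fun t ht => (hP t ht).continuousAt.continuousWithinAt
  refine ((hasDerivAt_liouvilleFactor hcont ht).mul ((h.hasDerivAt_snd t ht).add
    (((hP t ht).div_const 2).mul (h.hasDerivAt_fst t ht)))).congr_deriv ?_
  simp only [liouvillePotential, Pi.add_apply, Pi.mul_apply, smul_eq_mul]
  ring

theorem tendsto_liouvillePotential (μ : ℝ) (hL : Tendsto P atTop (𝓝 L))
    (hP' : Tendsto P' atTop (𝓝 0)) :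
    Tendsto (liouvillePotential P P' μ) atTop (𝓝 (μ - L ^ 2 / 4)) := by
  have hsub := (((hL.pow 2).div_const 4).const_sub μ).sub (hP'.div_const 2)
  rwa [zero_div, sub_zero] at hsub

theorem exists_neg (h : SolvesDampedODE P μ y z) (hP : ∀ t, 0 < t → HasDerivAt P (P' t) t)
    (hL : Tendsto P atTop (𝓝 L)) (hP' : Tendsto P' atTop (𝓝 0)) (hμ : L ^ 2 / 4 < μ)
    (hne : ∃ t, 0 < t ∧ y t ≠ 0) (R : ℝ) : ∃ t, R < t ∧ y t < 0 := by
  by_contra! hnonneg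
  obtain ⟨t₀, ht₀, hyt₀⟩ := hne
  have hcont : ContinuousOn P (Ioi 0) := fun t ht => (hP t ht).continuousAt.continuousWithinAt
  obtain ⟨c, hc, hcμ⟩ := exists_between (sub_pos.2 hμ)
  obtain ⟨N, hN⟩ := eventually_atTop.1
    ((tendsto_liouvillePotential μ hL hP').eventually_const_lt hcμ)
  obtain ⟨a, ha⟩ := exists_gt (max (max N R) t₀)
  obtain ⟨⟨hNa, hRa⟩, ht₀a⟩ : (N < a ∧ R < a) ∧ t₀ < a := by simpa using ha
  obtain ⟨t, ⟨hat, -⟩, hvt⟩ := exists_nonpos_of_sq_lt_potential (a := a) (Real.sqrt_pos.2 hc)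
    (fun s hs => h.hasDerivAt_liouville_fst hcont (show 0 < s by linarith [hs.1]))
    (fun s hs => h.hasDerivAt_liouville_snd hP (show 0 < s by linarith [hs.1]))
    (fun s hs => (Real.sq_sqrt hc.le).trans_lt (hN s (show N ≤ s by linarith [hs.1])))
  have hyt : y t = 0 := le_antisymm (nonpos_of_mul_nonpos_right hvt (liouvilleFactor_pos P t))
    (hnonneg t (hRa.trans hat))
  have hmin : IsLocalMin y t := by
    filter_upwards [Ioi_mem_nhds (hRa.trans hat)] with s hs
    exact hyt.trans_le (hnonneg s hs)
  have hzt : z t = 0 :=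
    hmin.hasDerivAt_eq_zero (h.hasDerivAt_fst t (ht₀.trans (ht₀a.trans hat)))
  exact hyt₀ (h.eq_zero_of_le ht₀ (ht₀a.trans hat).le (isCompact_Icc.bddAbove_image
    (hcont.mono fun s hs => ht₀.trans_le hs.1)) hyt hzt)

theorem exists_arch_length_bounds (hP : ∀ t, 0 < t → HasDerivAt P (P' t) t)
    (hL : Tendsto P atTop (𝓝 L)) (hP' : Tendsto P' atTop (𝓝 0)) (hμ : L ^ 2 / 4 < μ) :
    ∃ T₁ T₂ N : ℝ, 0 < T₁ ∧ 0 < T₂ ∧ 0 < N ∧ ∀ y z : ℝ → ℝ, SolvesDampedODE P μ y z → ∀ a b, N < a →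
      a < b → y a = 0 → y b = 0 → (∀ t ∈ Ioo a b, 0 < y t) → T₁ < b - a ∧ b - a < T₂ := by
  have hcont : ContinuousOn P (Ioi 0) := fun t ht => (hP t ht).continuousAt.continuousWithinAt
  obtain ⟨c, hc, hcμ⟩ := exists_between (sub_pos.2 hμ)
  obtain ⟨d, hd⟩ := exists_gt (μ - L ^ 2 / 4)
  have hd₀ : 0 < d := hc.trans (hcμ.trans hd)
  have hQ := tendsto_liouvillePotential μ hL hP'
  obtain ⟨N, hN⟩ := eventually_atTop.1
    ((hQ.eventually_const_lt hcμ).and (hQ.eventually_lt_const hd))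
  refine ⟨Real.pi / √d, Real.pi / √c, max N 1, by positivity, by positivity, by positivity,
    fun y z h a b ha hab hya hyb hpos => ?_⟩
  obtain ⟨hNa, ha₁⟩ := max_lt_iff.1 ha
  have hfst : ∀ t, a ≤ t → HasDerivAt _ _ t := fun t ht =>
    h.hasDerivAt_liouville_fst hcont (show 0 < t by linarith)
  have hsnd : ∀ t, a ≤ t → HasDerivAt _ _ t := fun t ht =>
    h.hasDerivAt_liouville_snd hP (show 0 < t by linarith)
  have hvpos : ∀ t ∈ Ioo a b, 0 < liouvilleFactor P t * y t := fun t ht =>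
    mul_pos (liouvilleFactor_pos P t) (hpos t ht)
  constructor
  · exact pi_div_lt_arch_length_of_potential_lt_sq (Real.sqrt_pos.2 hd₀) hab
      (fun t ht => hfst t ht.1) (fun t ht => hsnd t ht.1)
      (fun t ht => (hN t (hNa.trans ht.1).le).2.trans_eq (Real.sq_sqrt hd₀.le).symm)
      (by rw [hya, mul_zero]) (by rw [hyb, mul_zero]) hvpos
  · by_contra! hle
    obtain ⟨t, ht, hvt⟩ := exists_nonpos_of_sq_lt_potential (Real.sqrt_pos.2 hc)
      (fun t ht => hfst t ht.1) (fun t ht => hsnd t ht.1)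
      (fun t ht => (Real.sq_sqrt hc.le).trans_lt (hN t (hNa.trans ht.1).le).1)
    exact hvt.not_gt (hvpos t ⟨ht.1, by linarith [ht.2]⟩)

theorem exists_zero_spacing (h : SolvesDampedODE P μ y z)
    (hP : ∀ t, 0 < t → HasDerivAt P (P' t) t) (hL : Tendsto P atTop (𝓝 L))
    (hP' : Tendsto P' atTop (𝓝 0)) (hμ : L ^ 2 / 4 < μ) :
    ∃ T₁ T₂ N : ℝ, 0 < T₁ ∧ 0 < T₂ ∧ 0 < N ∧ ∀ a b, N < a → a < b → y a = 0 → y b = 0 →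
      (∀ t ∈ Ioo a b, y t ≠ 0) → T₁ < b - a ∧ b - a < T₂ := by
  obtain ⟨T₁, T₂, N, hT₁, hT₂, hN, hbounds⟩ := exists_arch_length_bounds hP hL hP' hμ
  refine ⟨T₁, T₂, N, hT₁, hT₂, hN, fun a b ha hab hya hyb hne => ?_⟩
  rcases forall_pos_or_forall_neg_of_ne_zero isPreconnected_Ioo (fun t ht =>
    (h.hasDerivAt_fst t (hN.trans (ha.trans ht.1))).continuousAt.continuousWithinAt) hne
    with hpos | hneg
  · exact hbounds y z h a b ha hab hya hyb hpos
  · exact hbounds _ _ h.neg a b ha hab (neg_eq_zero.2 hya) (neg_eq_zero.2 hyb)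
      fun t ht => neg_pos.2 (hneg t ht)

end SolvesDampedODE

section Sphere

variable {E : Type*} [NormedAddCommGroup E] [InnerProductSpace ℝ E]

/-- The action of a linear isometry on the unit sphere. -/
def unitSphereMap (e : E ≃ₗᵢ[ℝ] E) (s : Metric.sphere (0 : E) 1) : Metric.sphere (0 : E) 1 :=
  ⟨e s, by simp⟩

theorem continuous_unitSphereMap (e : E ≃ₗᵢ[ℝ] E) : Continuous (unitSphereMap e) :=
  (e.continuous.comp continuous_subtype_val).subtype_mk _

theorem injective_unitSphereMap (e : E ≃ₗᵢ[ℝ] E) : Function.Injective (unitSphereMap e) :=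
  fun _ _ h => Subtype.ext (e.injective (congrArg Subtype.val h))

theorem coe_image_preimage_unitSphereMap (e : E ≃ₗᵢ[ℝ] E) (A : Set (Metric.sphere (0 : E) 1)) :
    ((↑) '' (unitSphereMap e ⁻¹' A) : Set E) = e.symm '' ((↑) '' A) := by
  ext x
  constructor
  · rintro ⟨y, hy, rfl⟩
    exact ⟨e y, ⟨_, hy, rfl⟩, e.symm_apply_apply y⟩
  · rintro ⟨_, ⟨y, hy, rfl⟩, rfl⟩
    have hinv : unitSphereMap e (unitSphereMap e.symm y) = y := Subtype.ext (e.apply_symm_apply y)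
    exact ⟨unitSphereMap e.symm y, by rwa [mem_preimage, hinv], rfl⟩

open scoped Pointwise in
theorem measurePreserving_unitSphereMap [FiniteDimensional ℝ E] [MeasurableSpace E] [BorelSpace E]
    (e : E ≃ₗᵢ[ℝ] E) :
    MeasurePreserving (unitSphereMap e) (volume : Measure E).toSphere
      (volume : Measure E).toSphere := by
  have hmeas := (continuous_unitSphereMap e).measurable
  refine ⟨hmeas, Measure.ext fun A hA => ?_⟩
  have hcone : Ioo (0 : ℝ) 1 • (e.symm '' ((↑) '' A)) = e.symm '' (Ioo (0 : ℝ) 1 • ((↑) '' A)) :=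
    (image_image2_distrib_right (map_smul e.symm)).symm
  rw [Measure.map_apply hmeas hA, Measure.toSphere_apply' _ (hmeas hA),
    Measure.toSphere_apply' _ hA, coe_image_preimage_unitSphereMap, hcone,
    e.symm.image_eq_preimage_symm, e.symm_symm]
  congr 1
  exact e.measurePreserving.measure_preimage_equiv (f := e.toMeasurableEquiv) _

theorem exists_linearIsometryEquiv_apply_eq {v w : E} (h : ‖v‖ = ‖w‖) :
    ∃ e : E ≃ₗᵢ[ℝ] E, e v = w :=
  ⟨(ℝ ∙ (v - w))ᗮ.reflection, Submodule.reflection_sub h⟩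

theorem norm_smul_sub_smul_comm {v w : E} (h : ‖v‖ = ‖w‖) (a b : ℝ) :
    ‖a • v - b • w‖ = ‖a • w - b • v‖ := by
  rw [← sq_eq_sq₀ (norm_nonneg _) (norm_nonneg _), norm_sub_sq_real, norm_sub_sq_real,
    norm_smul, norm_smul, norm_smul, norm_smul, h, real_inner_smul_left, real_inner_smul_left,
    real_inner_smul_right, real_inner_smul_right, real_inner_comm]

end Sphere

section SphereMean

variable {V : Type*} [NormedAddCommGroup V] [NormedSpace ℝ V] {k : ℕ} {ρ η : ℝ}

/-- The rotation invariant probability measure on the unit sphere of `ℝ^(k+1)`. -/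
noncomputable def unitSphereProb (k : ℕ) : Measure (Metric.sphere (0 : Eucl k) 1) :=
  ((volume : Measure (Eucl k)).toSphere univ)⁻¹ • (volume : Measure (Eucl k)).toSphere

instance (k : ℕ) : IsProbabilityMeasure (unitSphereProb k) := by
  refine ⟨?_⟩
  rw [unitSphereProb, Measure.smul_apply, smul_eq_mul]
  exact ENNReal.inv_mul_cancel (Measure.measure_univ_ne_zero.2
    (Measure.toSphere_ne_zero (volume : Measure (Eucl k)))) (measure_ne_top _ _)

theorem sphereMean_eq_integral (k : ℕ) (hη : 0 < η) (f : Eucl k → V) :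
    sphereMean k η f = ∫ s, f (η • (s : Eucl k)) ∂unitSphereProb k := by
  have hemb : MeasurableEmbedding
      (fun s : Metric.sphere (0 : Eucl k) 1 => η • (s : Eucl k)) :=
    (measurableEmbedding_const_smul₀ hη.ne').comp
      (MeasurableEmbedding.subtype_coe Metric.isClosed_sphere.measurableSet)
  have hpow : 0 < η ^ k := pow_pos hη k
  rw [sphereMean, sphereMeasure, unitSphereProb, integral_smul_measure, integral_smul_measure,
    hemb.integral_map, measureReal_def, Measure.smul_apply, hemb.map_apply, preimage_univ,
    smul_smul, smul_eq_mul, ENNReal.toReal_mul, ENNReal.toReal_ofReal hpow.le, ENNReal.toReal_inv]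
  congr 1
  field_simp

theorem integral_unitSphereProb_comp (e : Eucl k ≃ₗᵢ[ℝ] Eucl k) (f : Eucl k → V) :
    ∫ s, f (e s) ∂unitSphereProb k = ∫ s, f s ∂unitSphereProb k := by
  rw [unitSphereProb, integral_smul_measure, integral_smul_measure]
  congr 1
  exact (measurePreserving_unitSphereMap e).integral_comp ((continuous_unitSphereMap
    e).measurableEmbedding (injective_unitSphereMap e)) fun s => f s

theorem omegaKernel_map (e : Eucl k ≃ₗᵢ[ℝ] Eucl k) (u m : Eucl k) :
    omegaKernel (e u) (e m) = omegaKernel u m := by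
  rw [omegaKernel, omegaKernel, ← map_sub, e.norm_map, e.norm_map, e.norm_map]

theorem omegaKernel_smul_smul_comm {v w : Eucl k} (h : ‖v‖ = ‖w‖) (a b : ℝ) :
    omegaKernel (a • v) (b • w) = omegaKernel (a • w) (b • v) := by
  rw [omegaKernel, omegaKernel, norm_smul_sub_smul_comm h]
  simp only [norm_smul, h]

-- Rotating the sphere moves the average from the boundary point to the interior one.
theorem integral_omegaKernel_eq_sphereMean (hρ : 0 < ρ) (hη : 0 < η) {u m : Eucl k}
    (hu : ‖u‖ = ρ) (hm : ‖m‖ = η) (f : ℝ → V) :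
    ∫ s, f (omegaKernel (ρ • (s : Eucl k)) m) ∂unitSphereProb k =
      sphereMean k η fun x => f (omegaKernel u x) := by
  have hm₁ : ‖η⁻¹ • m‖ = 1 := by
    rw [norm_smul, hm, norm_inv, Real.norm_of_nonneg hη.le, inv_mul_cancel₀ hη.ne']
  have hu₁ : ‖ρ⁻¹ • u‖ = 1 := by
    rw [norm_smul, hu, norm_inv, Real.norm_of_nonneg hρ.le, inv_mul_cancel₀ hρ.ne']
  obtain ⟨e, he⟩ := exists_linearIsometryEquiv_apply_eq (hu₁.trans hm₁.symm)
  rw [sphereMean_eq_integral k hη,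
    ← integral_unitSphereProb_comp e fun s => f (omegaKernel (ρ • s) m)]
  refine integral_congr_ae (Eventually.of_forall fun s => congrArg f ?_)
  have hnorm : ‖e s‖ = ‖e (ρ⁻¹ • u)‖ := by
    rw [e.norm_map, e.norm_map, hu₁, norm_eq_of_mem_sphere s]
  calc omegaKernel (ρ • e s) m = omegaKernel (ρ • e s) (η • e (ρ⁻¹ • u)) := by
        rw [he, smul_inv_smul₀ hη.ne']
    _ = omegaKernel (e u) (e (η • (s : Eucl k))) := by
        rw [omegaKernel_smul_smul_comm hnorm, ← map_smul, ← map_smul, smul_inv_smul₀ hρ.ne']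
    _ = omegaKernel u (η • (s : Eucl k)) := omegaKernel_map e u _

end SphereMean

section ParametricIntegral

variable {X : Type*} [TopologicalSpace X] [CompactSpace X] [MeasurableSpace X]
  [OpensMeasurableSpace X] {ν : Measure X} [IsFiniteMeasure ν]
  {E : Type*} [NormedAddCommGroup E] {Y : Type*} [NormedAddCommGroup Y]
  {V : Type*} [NormedAddCommGroup V] {c : X → Y} {U : Set E} {W : Set (Y × E)}

theorem integrable_comp_prodMk (hc : Continuous c) (hUW : ∀ s, ∀ m ∈ U, (c s, m) ∈ W)
    {G : Y × E → V} (hG : ContinuousOn G W) {m : E} (hm : m ∈ U) :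
    Integrable (fun s => G (c s, m)) ν :=
  (hG.comp_continuous (by fun_prop) fun s => hUW s m hm).integrable_of_hasCompactSupport
    (HasCompactSupport.of_compactSpace _)

variable [NormedSpace ℝ V]

theorem continuousOn_integral_comp (hc : Continuous c) (hUW : ∀ s, ∀ m ∈ U, (c s, m) ∈ W)
    {G : Y × E → V} (hG : ContinuousOn G W) : ContinuousOn (fun m => ∫ s, G (c s, m) ∂ν) U := by
  refine continuousOn_integral_of_compact_support (f := fun m s => G (c s, m)) isCompact_univ
    ?_ fun p x _ hx => absurd (mem_univ x) hx
  exact hG.comp (f := fun q : E × X => (c q.2, q.1)) (by fun_prop) fun q hq => hUW q.2 q.1 hq.1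

variable [NormedSpace ℝ E] [FiniteDimensional ℝ E] [NormedSpace ℝ Y]

theorem hasFDerivAt_integral_comp (hc : Continuous c) (hU : IsOpen U) (hW : IsOpen W)
    (hUW : ∀ s, ∀ m ∈ U, (c s, m) ∈ W) {G : Y × E → V} (hG : ContDiffOn ℝ 1 G W) {m : E}
    (hm : m ∈ U) :
    HasFDerivAt (fun m => ∫ s, G (c s, m) ∂ν)
      (∫ s, (fderiv ℝ G (c s, m)).comp (ContinuousLinearMap.inr ℝ Y E) ∂ν) m := by
  have hproper : ProperSpace E := FiniteDimensional.proper ℝ E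
  have hG' : ContinuousOn (fun q => (fderiv ℝ G q).comp (ContinuousLinearMap.inr ℝ Y E)) W :=
    (hG.continuousOn_fderiv_of_isOpen hW le_rfl).clm_comp continuousOn_const
  obtain ⟨r, hr, hrU⟩ := Metric.nhds_basis_closedBall.mem_iff.1 (hU.mem_nhds hm)
  have hK : IsCompact ((univ : Set X) ×ˢ Metric.closedBall m r) :=
    isCompact_univ.prod (isCompact_closedBall m r)
  obtain ⟨C, hC⟩ := hK.exists_bound_of_continuousOn (hG'.comp
    (f := fun q : X × E => (c q.1, q.2)) (by fun_prop) fun q hq => hUW q.1 q.2 (hrU hq.2))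
  refine hasFDerivAt_integral_of_dominated_of_fderiv_le (bound := fun _ => C)
    (F' := fun m s => (fderiv ℝ G (c s, m)).comp (ContinuousLinearMap.inr ℝ Y E))
    (Metric.closedBall_mem_nhds m hr) ?_ (integrable_comp_prodMk hc hUW hG.continuousOn hm)
    (integrable_comp_prodMk hc hUW hG' hm).aestronglyMeasurable
    (Eventually.of_forall fun s x hx => hC (s, x) ⟨mem_univ _, hx⟩) (integrable_const C)
    (Eventually.of_forall fun s x hx => ?_)
  · filter_upwards [hU.mem_nhds hm] with x hx
      using (integrable_comp_prodMk hc hUW hG.continuousOn hx).aestronglyMeasurable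
  · have hder : HasFDerivAt G (fderiv ℝ G (c s, x)) (c s, x) :=
      ((hG.contDiffAt (hW.mem_nhds (hUW s x (hrU hx)))).differentiableAt one_ne_zero).hasFDerivAt
    exact hder.comp x (hasFDerivAt_prodMk_right (c s) x)

theorem fderiv_integral_comp_apply (hc : Continuous c) (hU : IsOpen U) (hW : IsOpen W)
    (hUW : ∀ s, ∀ m ∈ U, (c s, m) ∈ W) {G : Y × E → V} (hG : ContDiffOn ℝ 1 G W) {m : E}
    (hm : m ∈ U) (v : E) :
    fderiv ℝ (fun m => ∫ s, G (c s, m) ∂ν) m v = ∫ s, fderiv ℝ G (c s, m) (0, v) ∂ν := by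
  have hG' : ContinuousOn (fun q => (fderiv ℝ G q).comp (ContinuousLinearMap.inr ℝ Y E)) W :=
    (hG.continuousOn_fderiv_of_isOpen hW le_rfl).clm_comp continuousOn_const
  rw [(hasFDerivAt_integral_comp hc hU hW hUW hG hm).fderiv,
    ContinuousLinearMap.integral_apply (integrable_comp_prodMk hc hUW hG' hm)]
  simp

theorem contDiffOn_integral_comp (hc : Continuous c) (hU : IsOpen U) (hW : IsOpen W)
    (hUW : ∀ s, ∀ m ∈ U, (c s, m) ∈ W) {n : ℕ} {G : Y × E → V} (hG : ContDiffOn ℝ n G W) :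
    ContDiffOn ℝ n (fun m => ∫ s, G (c s, m) ∂ν) U := by
  induction n generalizing G with
  | zero =>
    rw [Nat.cast_zero, contDiffOn_zero] at hG ⊢
    exact continuousOn_integral_comp hc hUW hG
  | succ n ih =>
    have hG₁ : ContDiffOn ℝ 1 G W := hG.of_le (by norm_num)
    rw [Nat.cast_succ, contDiffOn_succ_iff_fderiv_apply hU.uniqueDiffOn]
    refine ⟨fun m hm => (hasFDerivAt_integral_comp hc hU hW hUW
      hG₁ hm).differentiableAt.differentiableWithinAt, fun h => absurd h (by simp), fun v => ?_⟩
    have hG' : ContDiffOn ℝ n (fun q => fderiv ℝ G q (0, v)) W :=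
      (hG.fderiv_of_isOpen hW (by norm_num)).clm_apply contDiffOn_const
    refine (ih hG').congr fun m hm => ?_
    rw [fderivWithin_of_isOpen hU hm, fderiv_integral_comp_apply hc hU hW hUW hG₁ hm]

end ParametricIntegral

section PartialDeriv

variable {k : ℕ} {F G : Eucl k → ℂ} {m : Eucl k}

theorem partialDeriv_congr (h : F =ᶠ[𝓝 m] G) (i : Fin (k + 1)) :
    partialDeriv i F m = partialDeriv i G m := by
  rw [partialDeriv, partialDeriv, h.fderiv_eq]

theorem partialDeriv_sub (hF : DifferentiableAt ℝ F m) (hG : DifferentiableAt ℝ G m)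
    (i : Fin (k + 1)) :
    partialDeriv i (fun x => F x - G x) m = partialDeriv i F m - partialDeriv i G m := by
  rw [partialDeriv, fderiv_fun_sub hF hG]
  rfl

theorem partialDeriv_mul (hF : DifferentiableAt ℝ F m) (hG : DifferentiableAt ℝ G m)
    (i : Fin (k + 1)) :
    partialDeriv i (fun x => F x * G x) m =
      F m * partialDeriv i G m + partialDeriv i F m * G m := by
  rw [partialDeriv, fderiv_fun_mul hF hG]
  simp [partialDeriv, mul_comm]

theorem partialDeriv_ofReal {h : Eucl k → ℝ} {h' : Eucl k →L[ℝ] ℝ} (hh : HasFDerivAt h h' m)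
    (i : Fin (k + 1)) :
    partialDeriv i (fun x => (h x : ℂ)) m = (h' (EuclideanSpace.single i 1) : ℝ) := by
  have hcomp : HasFDerivAt (fun x => (h x : ℂ)) (Complex.ofRealCLM.comp h') m :=
    Complex.ofRealCLM.hasFDerivAt.comp m hh
  rw [partialDeriv, hcomp.fderiv]
  simp

theorem partialDeriv_comp {g : ℝ → ℂ} {g' : ℂ} {h : Eucl k → ℝ} (hg : HasDerivAt g g' (h m))
    (hh : DifferentiableAt ℝ h m) (i : Fin (k + 1)) :
    partialDeriv i (fun x => g (h x)) m = g' * partialDeriv i (fun x => (h x : ℂ)) m := by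
  have hcomp : HasFDerivAt (fun x => g (h x)) _ m := hg.hasFDerivAt.comp m hh.hasFDerivAt
  rw [partialDeriv_ofReal hh.hasFDerivAt, partialDeriv, hcomp.fderiv]
  simp [mul_comm]

theorem contDiffAt_ofReal_comp {h : Eucl k → ℝ} {n : WithTop ℕ∞} (hh : ContDiffAt ℝ n h m) :
    ContDiffAt ℝ n (fun x => (h x : ℂ)) m :=
  Complex.ofRealCLM.contDiff.contDiffAt.comp m hh

theorem contDiffAt_partialDeriv (hF : ContDiffAt ℝ 2 F m) (i : Fin (k + 1)) :
    ContDiffAt ℝ 1 (partialDeriv i F) m :=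
  (hF.fderiv_right (m := 1) (by norm_num)).clm_apply contDiffAt_const

theorem partialDeriv_apply_self (i : Fin (k + 1)) (m : Eucl k) :
    partialDeriv i (fun x => (x i : ℂ)) m = 1 := by
  refine (partialDeriv_ofReal (EuclideanSpace.proj (𝕜 := ℝ) i).hasFDerivAt i).trans ?_
  simp

theorem partialDeriv_norm_sub_sq (c : Eucl k) (i : Fin (k + 1)) (m : Eucl k) :
    partialDeriv i (fun x => ((‖x - c‖ ^ 2 : ℝ) : ℂ)) m = 2 * (m i - c i) := by
  refine (partialDeriv_ofReal ((hasFDerivAt_id m).sub_const c).norm_sq i).trans ?_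
  simp [EuclideanSpace.inner_single_right]

theorem partialDeriv_norm_sq (i : Fin (k + 1)) (m : Eucl k) :
    partialDeriv i (fun x => ((‖x‖ ^ 2 : ℝ) : ℂ)) m = 2 * m i := by
  simpa using partialDeriv_norm_sub_sq 0 i m

theorem partialDeriv_partialDeriv_norm_sub_sq (c : Eucl k) (i : Fin (k + 1)) (m : Eucl k) :
    partialDeriv i (partialDeriv i fun x => ((‖x - c‖ ^ 2 : ℝ) : ℂ)) m = 2 := by
  rw [funext (partialDeriv_norm_sub_sq c i), partialDeriv_mul (by fun_prop) (by fun_prop),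
    partialDeriv_sub (by fun_prop) (by fun_prop), partialDeriv_apply_self]
  simp [partialDeriv]

end PartialDeriv

section HyperbolicLaplacian

variable {k : ℕ} {ρ : ℝ} {F G : Eucl k → ℂ} {m : Eucl k}

theorem sq_sub_norm_sq_pos (hm : ‖m‖ < ρ) : 0 < ρ ^ 2 - ‖m‖ ^ 2 := by
  nlinarith [norm_nonneg m]

theorem contDiffAt_conformalFactor_pow (hm : ‖m‖ < ρ) (n : ℕ) :
    ContDiffAt ℝ 1 (fun x : Eucl k => (conformalFactor k ρ x : ℂ) ^ n) m := by
  have hσ : ContDiffAt ℝ 1 (fun x : Eucl k => conformalFactor k ρ x) m :=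
    contDiffAt_const.div (contDiffAt_const.sub (contDiff_id.norm_sq ℝ).contDiffAt)
      (sq_sub_norm_sq_pos hm).ne'
  exact (contDiffAt_ofReal_comp hσ).pow n

theorem partialDeriv_conformalFactor_pow (hm : ‖m‖ < ρ) (n : ℕ) (i : Fin (k + 1)) :
    partialDeriv i (fun x : Eucl k => (conformalFactor k ρ x : ℂ) ^ n) m =
      (conformalFactor k ρ m : ℂ) ^ n * (n * (2 * m i / (ρ ^ 2 - ‖m‖ ^ 2))) := by
  have hA := (sq_sub_norm_sq_pos hm).ne'
  have hderiv : HasDerivAt (fun t : ℝ => ((2 * ρ ^ 2 / (ρ ^ 2 - t) : ℝ) : ℂ) ^ n)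
      ((n * (2 * ρ ^ 2 / (ρ ^ 2 - ‖m‖ ^ 2)) ^ n / (ρ ^ 2 - ‖m‖ ^ 2) : ℝ) : ℂ) (‖m‖ ^ 2) := by
    have hpow := ((hasDerivAt_const (‖m‖ ^ 2) (2 * ρ ^ 2)).fun_div
      ((hasDerivAt_id _).const_sub (ρ ^ 2)) hA).fun_pow n
    refine (HasDerivAt.ofReal_comp (hpow.congr_deriv ?_)).congr_of_eventuallyEq
      (Eventually.of_forall fun t => by simp)
    simp only [id]
    generalize ρ ^ 2 - ‖m‖ ^ 2 = A at hA
    cases n with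
    | zero => simp
    | succ n =>
      rw [Nat.add_sub_cancel, pow_succ _ n]
      field_simp
      ring
  have hdiff : DifferentiableAt ℝ (fun x : Eucl k => ‖x‖ ^ 2) m :=
    (contDiff_norm_sq ℝ (n := 1)).differentiable one_ne_zero m
  refine (partialDeriv_comp hderiv hdiff i).trans ?_
  rw [conformalFactor, partialDeriv_norm_sq]
  push_cast
  ring

theorem hyperbolicLaplacian_eq (hk : 1 ≤ k) (hm : ‖m‖ < ρ)
    (hF : ∀ i, DifferentiableAt ℝ (partialDeriv i F) m) :
    hyperbolicLaplacian k ρ F m = ((conformalFactor k ρ m : ℂ) ^ 2)⁻¹ *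
      (∑ i, partialDeriv i (partialDeriv i F) m +
        (k - 1) * (2 / (ρ ^ 2 - ‖m‖ ^ 2)) * ∑ i, m i * partialDeriv i F m) := by
  have hσ : (conformalFactor k ρ m : ℂ) ^ (k - 1) ≠ 0 := by
    have hA := sq_sub_norm_sq_pos hm
    have hρ := (norm_nonneg m).trans_lt hm
    exact pow_ne_zero _ (Complex.ofReal_ne_zero.2 (by rw [conformalFactor]; positivity))
  have hterm : ∀ i, partialDeriv i
      (fun x => (conformalFactor k ρ x : ℂ) ^ (k - 1) * partialDeriv i F x) m =
      (conformalFactor k ρ m : ℂ) ^ (k - 1) * (partialDeriv i (partialDeriv i F) m +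
        (k - 1) * (2 / (ρ ^ 2 - ‖m‖ ^ 2)) * (m i * partialDeriv i F m)) := fun i => by
    rw [partialDeriv_mul
      ((contDiffAt_conformalFactor_pow hm _).differentiableAt one_ne_zero) (hF i),
      partialDeriv_conformalFactor_pow hm, Nat.cast_sub hk, Nat.cast_one]
    ring
  have hpow : (conformalFactor k ρ m : ℂ) ^ (k + 1) =
      (conformalFactor k ρ m : ℂ) ^ (k - 1) * (conformalFactor k ρ m : ℂ) ^ 2 := by
    rw [← pow_add]
    congr 1
    omega
  rw [hyperbolicLaplacian, Finset.sum_congr rfl fun i _ => hterm i, ← Finset.mul_sum,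
    Finset.sum_add_distrib, ← Finset.mul_sum, hpow, mul_inv_rev, mul_assoc, inv_mul_cancel_left₀ hσ]

theorem hyperbolicLaplacian_congr (h : F =ᶠ[𝓝 m] G) :
    hyperbolicLaplacian k ρ F m = hyperbolicLaplacian k ρ G m := by
  rw [hyperbolicLaplacian, hyperbolicLaplacian]
  congr 1
  refine Finset.sum_congr rfl fun i _ => partialDeriv_congr ?_ i
  filter_upwards [h.eventuallyEq_nhds] with x hx
  rw [partialDeriv_congr hx]

theorem hyperbolicLaplacian_sub (hk : 1 ≤ k) (hm : ‖m‖ < ρ) (hF : ContDiffAt ℝ 2 F m)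
    (hG : ContDiffAt ℝ 2 G m) :
    hyperbolicLaplacian k ρ (fun x => F x - G x) m =
      hyperbolicLaplacian k ρ F m - hyperbolicLaplacian k ρ G m := by
  have hdiff : ∀ {H : Eucl k → ℂ}, ContDiffAt ℝ 2 H m →
      ∀ i, DifferentiableAt ℝ (partialDeriv i H) m := fun hH i =>
    (contDiffAt_partialDeriv hH i).differentiableAt one_ne_zero
  have hfst : ∀ᶠ x in 𝓝 m, ∀ i, partialDeriv i (fun x => F x - G x) x =
      partialDeriv i F x - partialDeriv i G x := by
    filter_upwards [hF.eventually (by simp), hG.eventually (by simp)] with x hFx hGx i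
      using partialDeriv_sub (hFx.differentiableAt two_ne_zero) (hGx.differentiableAt two_ne_zero) i
  have hsnd : ∀ i, partialDeriv i (partialDeriv i fun x => F x - G x) m =
      partialDeriv i (partialDeriv i F) m - partialDeriv i (partialDeriv i G) m := fun i => by
    rw [partialDeriv_congr (hfst.mono fun x hx => hx i),
      partialDeriv_sub (hdiff hF i) (hdiff hG i)]
  rw [hyperbolicLaplacian_eq hk hm (hdiff (hF.sub hG)), hyperbolicLaplacian_eq hk hm (hdiff hF),
    hyperbolicLaplacian_eq hk hm (hdiff hG)]
  simp only [hsnd, hfst.self_of_nhds, mul_sub, Finset.sum_sub_distrib]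
  ring

/-- Beltrami's first differential parameter `|∇F|² = gⁱʲ ∂ᵢF ∂ⱼF` of the ball model; it is the
coefficient of the second derivative when the hyperbolic Laplacian is applied to a composition.
For complex-valued `F` it is the bilinear, not the Hermitian, square. -/
noncomputable def hyperbolicGradSq (k : ℕ) (ρ : ℝ) (F : Eucl k → ℂ) (m : Eucl k) : ℂ :=
  ((conformalFactor k ρ m : ℂ) ^ 2)⁻¹ * ∑ i, partialDeriv i F m ^ 2

variable {g g' : ℝ → ℂ} {g'' : ℂ} {h : Eucl k → ℝ}

theorem hyperbolicGradSq_comp {a : ℂ} (hg : HasDerivAt g a (h m)) (hh : DifferentiableAt ℝ h m) :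
    hyperbolicGradSq k ρ (fun x => g (h x)) m =
      a ^ 2 * hyperbolicGradSq k ρ (fun x => (h x : ℂ)) m := by
  simp only [hyperbolicGradSq, partialDeriv_comp hg hh, mul_pow, ← Finset.mul_sum]
  ring

theorem hyperbolicLaplacian_comp (hk : 1 ≤ k) (hm : ‖m‖ < ρ) (hh : ContDiffAt ℝ 2 h m)
    (hg : ∀ᶠ t in 𝓝 (h m), HasDerivAt g (g' t) t) (hg' : HasDerivAt g' g'' (h m)) :
    hyperbolicLaplacian k ρ (fun x => g (h x)) m =
      g'' * hyperbolicGradSq k ρ (fun x => (h x : ℂ)) m +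
        g' (h m) * hyperbolicLaplacian k ρ (fun x => (h x : ℂ)) m := by
  have hh₁ : DifferentiableAt ℝ h m := hh.differentiableAt two_ne_zero
  have hdh : ∀ i, DifferentiableAt ℝ (partialDeriv i fun x => (h x : ℂ)) m := fun i =>
    (contDiffAt_partialDeriv (contDiffAt_ofReal_comp hh) i).differentiableAt one_ne_zero
  have hdg : DifferentiableAt ℝ (fun x => g' (h x)) m :=
    hg'.differentiableAt.comp m hh₁
  have hfst : ∀ i, partialDeriv i (fun x => g (h x)) =ᶠ[𝓝 m]
      fun x => g' (h x) * partialDeriv i (fun x => (h x : ℂ)) x := fun i => by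
    filter_upwards [hh.eventually (by simp), hh₁.continuousAt.eventually hg] with x hhx hgx
      using partialDeriv_comp hgx (hhx.differentiableAt two_ne_zero) i
  have hsnd : ∀ i, partialDeriv i (partialDeriv i fun x => g (h x)) m =
      g' (h m) * partialDeriv i (partialDeriv i fun x => (h x : ℂ)) m +
        g'' * partialDeriv i (fun x => (h x : ℂ)) m ^ 2 := fun i => by
    rw [partialDeriv_congr (hfst i), partialDeriv_mul hdg (hdh i), partialDeriv_comp hg' hh₁]
    ring
  rw [hyperbolicLaplacian_eq hk hm fun i => (hdg.mul (hdh i)).congr_of_eventuallyEq (hfst i),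
    hyperbolicLaplacian_eq hk hm hdh, hyperbolicGradSq]
  simp only [hsnd, fun i => (hfst i).self_of_nhds, Finset.sum_add_distrib, ← Finset.mul_sum,
    mul_left_comm _ (g' (h m))]
  ring

end HyperbolicLaplacian

section IntegralInterchange

variable {k : ℕ} {X : Type*} [TopologicalSpace X] [CompactSpace X] [MeasurableSpace X]
  [OpensMeasurableSpace X] {ν : Measure X} [IsFiniteMeasure ν]
  {Y : Type*} [NormedAddCommGroup Y] [NormedSpace ℝ Y] {c : X → Y} {U : Set (Eucl k)}
  {W : Set (Y × Eucl k)} {G : Y × Eucl k → ℂ} {m : Eucl k}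

theorem partialDeriv_comp_prodMk {y : Y} (hG : DifferentiableAt ℝ G (y, m)) (i : Fin (k + 1)) :
    partialDeriv i (fun x => G (y, x)) m = fderiv ℝ G (y, m) (0, EuclideanSpace.single i 1) := by
  have hcomp : HasFDerivAt (fun x => G (y, x)) _ m :=
    hG.hasFDerivAt.comp m (hasFDerivAt_prodMk_right y m)
  rw [partialDeriv, hcomp.fderiv]
  simp

theorem integrable_partialDeriv (hc : Continuous c) (hW : IsOpen W)
    (hUW : ∀ s, ∀ m ∈ U, (c s, m) ∈ W) (hG : ContDiffOn ℝ 1 G W) (hm : m ∈ U)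
    (i : Fin (k + 1)) : Integrable (fun s => partialDeriv i (fun x => G (c s, x)) m) ν := by
  have hG' : ContinuousOn (fun q => fderiv ℝ G q (0, EuclideanSpace.single i 1)) W :=
    (hG.continuousOn_fderiv_of_isOpen hW le_rfl).clm_apply continuousOn_const
  refine (integrable_comp_prodMk hc hUW hG' hm).congr (Eventually.of_forall fun s => ?_)
  exact (partialDeriv_comp_prodMk ((hG.contDiffAt (hW.mem_nhds (hUW s m hm))).differentiableAt
    one_ne_zero) i).symm

theorem partialDeriv_integral (hc : Continuous c) (hU : IsOpen U) (hW : IsOpen W)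
    (hUW : ∀ s, ∀ m ∈ U, (c s, m) ∈ W) (hG : ContDiffOn ℝ 1 G W) (hm : m ∈ U)
    (i : Fin (k + 1)) :
    partialDeriv i (fun x => ∫ s, G (c s, x) ∂ν) m =
      ∫ s, partialDeriv i (fun x => G (c s, x)) m ∂ν := by
  rw [partialDeriv, fderiv_integral_comp_apply hc hU hW hUW hG hm]
  refine integral_congr_ae (Eventually.of_forall fun s => ?_)
  exact (partialDeriv_comp_prodMk ((hG.contDiffAt (hW.mem_nhds (hUW s m hm))).differentiableAt
    one_ne_zero) i).symm

theorem partialDeriv_partialDeriv_integral (hc : Continuous c) (hU : IsOpen U) (hW : IsOpen W)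
    (hUW : ∀ s, ∀ m ∈ U, (c s, m) ∈ W) (hG : ContDiffOn ℝ 2 G W) (hm : m ∈ U)
    (i : Fin (k + 1)) :
    Integrable (fun s => partialDeriv i (partialDeriv i fun x => G (c s, x)) m) ν ∧
      partialDeriv i (partialDeriv i fun x => ∫ s, G (c s, x) ∂ν) m =
        ∫ s, partialDeriv i (partialDeriv i fun x => G (c s, x)) m ∂ν := by
  have hG₁ : ContDiffOn ℝ 1 G W := hG.of_le one_le_two
  have hG' : ContDiffOn ℝ 1 (fun q => fderiv ℝ G q (0, EuclideanSpace.single i 1)) W :=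
    (hG.fderiv_of_isOpen hW (by norm_num)).clm_apply contDiffOn_const
  have hfst : ∀ s, partialDeriv i (fun x => G (c s, x)) =ᶠ[𝓝 m]
      fun x => fderiv ℝ G (c s, x) (0, EuclideanSpace.single i 1) := fun s => by
    filter_upwards [hU.mem_nhds hm] with x hx
    exact partialDeriv_comp_prodMk
      ((hG₁.contDiffAt (hW.mem_nhds (hUW s x hx))).differentiableAt one_ne_zero) i
  have hfst_integral : (partialDeriv i fun x => ∫ s, G (c s, x) ∂ν) =ᶠ[𝓝 m]
      fun x => ∫ s, fderiv ℝ G (c s, x) (0, EuclideanSpace.single i 1) ∂ν := by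
    filter_upwards [hU.mem_nhds hm] with x hx
      using fderiv_integral_comp_apply hc hU hW hUW hG₁ hx _
  simp only [fun s => partialDeriv_congr (hfst s) i, partialDeriv_congr hfst_integral i]
  exact ⟨integrable_partialDeriv hc hW hUW hG' hm i, partialDeriv_integral hc hU hW hUW hG' hm i⟩

theorem hyperbolicLaplacian_integral (hk : 1 ≤ k) {ρ : ℝ} (hc : Continuous c) (hW : IsOpen W)
    (hUW : ∀ s, ∀ m ∈ Metric.ball (0 : Eucl k) ρ, (c s, m) ∈ W) (hG : ContDiffOn ℝ 2 G W)
    (hm : m ∈ Metric.ball (0 : Eucl k) ρ) :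
    hyperbolicLaplacian k ρ (fun x => ∫ s, G (c s, x) ∂ν) m =
      ∫ s, hyperbolicLaplacian k ρ (fun x => G (c s, x)) m ∂ν := by
  have hU : IsOpen (Metric.ball (0 : Eucl k) ρ) := Metric.isOpen_ball
  have hG₁ : ContDiffOn ℝ 1 G W := hG.of_le one_le_two
  have hmρ : ‖m‖ < ρ := mem_ball_zero_iff.1 hm
  have hdiff : ∀ {F : Eucl k → ℂ}, ContDiffAt ℝ 2 F m →
      ∀ i, DifferentiableAt ℝ (partialDeriv i F) m := fun hF i =>
    (contDiffAt_partialDeriv hF i).differentiableAt one_ne_zero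
  have hintegral : ContDiffAt ℝ 2 (fun x => ∫ s, G (c s, x) ∂ν) m :=
    (contDiffOn_integral_comp (n := 2) hc hU hW hUW hG).contDiffAt (hU.mem_nhds hm)
  have hslice : ∀ s, ContDiffAt ℝ 2 (fun x => G (c s, x)) m := fun s =>
    (hG.contDiffAt (hW.mem_nhds (hUW s m hm))).comp m (contDiffAt_const.prodMk contDiffAt_id)
  have hfst := fun i => integrable_partialDeriv (ν := ν) hc hW hUW hG₁ hm i
  have hsnd := fun i => partialDeriv_partialDeriv_integral (ν := ν) hc hU hW hUW hG hm i
  simp only [hyperbolicLaplacian_eq hk hmρ (hdiff hintegral),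
    fun s => hyperbolicLaplacian_eq hk hmρ (hdiff (hslice s)), (hsnd _).2,
    partialDeriv_integral hc hU hW hUW hG₁ hm, ← integral_const_mul]
  rw [← integral_finsetSum _ fun i _ => (hsnd i).1,
    ← integral_finsetSum _ fun i _ => (hfst i).const_mul _, ← integral_const_mul,
    ← integral_add (integrable_finsetSum _ fun i _ => (hsnd i).1)
      ((integrable_finsetSum _ fun i _ => (hfst i).const_mul _).const_mul _),
    ← integral_const_mul]

end IntegralInterchange

section OmegaKernel

variable {k : ℕ} {ρ : ℝ} {u m : Eucl k}

theorem inv_conformalFactor_sq (k : ℕ) (ρ : ℝ) (m : Eucl k) :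
    ((conformalFactor k ρ m : ℂ) ^ 2)⁻¹ = ((ρ : ℂ) ^ 2 - ‖m‖ ^ 2) ^ 2 / (4 * ρ ^ 4) := by
  rw [conformalFactor, ← inv_pow]
  push_cast
  rw [inv_div, div_pow]
  ring

theorem sum_sq_sub (c m : Eucl k) : ∑ i, ((m i : ℂ) - c i) ^ 2 = (‖m - c‖ : ℂ) ^ 2 := by
  have hsum : ∑ i, (m i - c i) ^ 2 = ‖m - c‖ ^ 2 := by simp [EuclideanSpace.norm_sq_eq]
  exact_mod_cast hsum

theorem sum_sq (m : Eucl k) : ∑ i, (m i : ℂ) ^ 2 = (‖m‖ : ℂ) ^ 2 := by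
  simpa using sum_sq_sub 0 m

-- The polarization identity for `⟪m, m - c⟫`.
theorem sum_mul_sub (c m : Eucl k) :
    ∑ i, (m i : ℂ) * (m i - c i) = ((‖m‖ : ℂ) ^ 2 + ‖m - c‖ ^ 2 - ‖c‖ ^ 2) / 2 := by
  rw [← sum_sq m, ← sum_sq c, ← sum_sq_sub, ← Finset.sum_add_distrib, ← Finset.sum_sub_distrib,
    Finset.sum_div]
  exact Finset.sum_congr rfl fun i _ => by ring

theorem hyperbolicGradSq_norm_sub_sq (c : Eucl k) :
    hyperbolicGradSq k ρ (fun x => ((‖x - c‖ ^ 2 : ℝ) : ℂ)) m =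
      ((conformalFactor k ρ m : ℂ) ^ 2)⁻¹ * (4 * ‖m - c‖ ^ 2) := by
  simp only [hyperbolicGradSq, partialDeriv_norm_sub_sq, mul_pow, ← Finset.mul_sum, sum_sq_sub]
  norm_num

theorem contDiff_norm_sub_sq (c : Eucl k) : ContDiff ℝ 2 fun x => ‖x - c‖ ^ 2 :=
  (contDiff_id.sub contDiff_const).norm_sq ℝ

theorem hyperbolicLaplacian_norm_sub_sq (hk : 1 ≤ k) (hm : ‖m‖ < ρ) (c : Eucl k) :
    hyperbolicLaplacian k ρ (fun x => ((‖x - c‖ ^ 2 : ℝ) : ℂ)) m =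
      ((conformalFactor k ρ m : ℂ) ^ 2)⁻¹ * (2 * (k + 1) +
        (k - 1) * (2 / (ρ ^ 2 - ‖m‖ ^ 2)) * (‖m‖ ^ 2 + ‖m - c‖ ^ 2 - ‖c‖ ^ 2)) := by
  have hdiff := contDiffAt_ofReal_comp (contDiff_norm_sub_sq c).contDiffAt (m := m)
  rw [hyperbolicLaplacian_eq hk hm fun i =>
    (contDiffAt_partialDeriv hdiff i).differentiableAt one_ne_zero]
  simp only [partialDeriv_partialDeriv_norm_sub_sq, partialDeriv_norm_sub_sq,
    mul_left_comm _ (2 : ℂ), ← Finset.mul_sum, sum_mul_sub, Finset.sum_const,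
    Finset.card_univ, Fintype.card_fin, nsmul_eq_mul]
  push_cast
  ring

theorem contDiff_const_sub_norm_sq (c : ℝ) : ContDiff ℝ 2 fun x : Eucl k => c - ‖x‖ ^ 2 :=
  contDiff_const.sub (contDiff_norm_sq ℝ)

theorem partialDeriv_const_sub_norm_sq (c : ℝ) (i : Fin (k + 1)) (m : Eucl k) :
    partialDeriv i (fun x => ((c - ‖x‖ ^ 2 : ℝ) : ℂ)) m = -(2 * m i) := by
  refine (partialDeriv_ofReal (((hasFDerivAt_id m).norm_sq).const_sub c) i).trans ?_
  simp [EuclideanSpace.inner_single_right]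

theorem hyperbolicGradSq_const_sub_norm_sq (c : ℝ) :
    hyperbolicGradSq k ρ (fun x => ((c - ‖x‖ ^ 2 : ℝ) : ℂ)) m =
      ((conformalFactor k ρ m : ℂ) ^ 2)⁻¹ * (4 * ‖m‖ ^ 2) := by
  simp only [hyperbolicGradSq, partialDeriv_const_sub_norm_sq, neg_sq, mul_pow, ← Finset.mul_sum,
    sum_sq]
  norm_num

theorem hyperbolicLaplacian_const_sub_norm_sq (hk : 1 ≤ k) (hm : ‖m‖ < ρ) (c : ℝ) :
    hyperbolicLaplacian k ρ (fun x => ((c - ‖x‖ ^ 2 : ℝ) : ℂ)) m =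
      -(((conformalFactor k ρ m : ℂ) ^ 2)⁻¹ * (2 * (k + 1) +
        (k - 1) * (2 / (ρ ^ 2 - ‖m‖ ^ 2)) * (2 * ‖m‖ ^ 2))) := by
  have hneg : ∀ t : ℝ, HasDerivAt (fun t : ℝ => ((c - t : ℝ) : ℂ)) (-1) t := fun t => by
    simpa using ((hasDerivAt_id t).const_sub c).ofReal_comp
  have hcomp := hyperbolicLaplacian_comp hk hm (contDiff_norm_sub_sq 0).contDiffAt
    (Eventually.of_forall hneg) (hasDerivAt_const _ _)
  rw [hyperbolicLaplacian_norm_sub_sq hk hm] at hcomp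
  simp only [sub_zero, norm_zero, Complex.ofReal_zero] at hcomp
  rw [hcomp]
  ring

theorem hasDerivAt_ofReal_log {t : ℝ} (h : 0 < t) :
    HasDerivAt (fun t => (Real.log t : ℂ)) ((t⁻¹ : ℝ) : ℂ) t :=
  (Real.hasDerivAt_log h.ne').ofReal_comp

theorem hyperbolicLaplacian_log (hk : 1 ≤ k) (hm : ‖m‖ < ρ) {h : Eucl k → ℝ}
    (hh : ContDiffAt ℝ 2 h m) (hpos : 0 < h m) :
    hyperbolicLaplacian k ρ (fun x => (Real.log (h x) : ℂ)) m =
      -((h m : ℂ) ^ 2)⁻¹ * hyperbolicGradSq k ρ (fun x => (h x : ℂ)) m +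
        (h m : ℂ)⁻¹ * hyperbolicLaplacian k ρ (fun x => (h x : ℂ)) m := by
  have hlog : ∀ᶠ t in 𝓝 (h m), HasDerivAt (fun t => (Real.log t : ℂ)) ((t⁻¹ : ℝ) : ℂ) t :=
    (eventually_gt_nhds hpos).mono fun t ht => hasDerivAt_ofReal_log ht
  rw [hyperbolicLaplacian_comp hk hm hh hlog (hasDerivAt_inv hpos.ne').ofReal_comp]
  push_cast
  ring

theorem norm_sub_pos_of_norm_lt (h : ‖m‖ < ‖u‖) : 0 < ‖m - u‖ :=
  norm_pos_iff.2 (sub_ne_zero.2 fun hmu => h.ne (congrArg norm hmu))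

theorem omegaKernel_pos (h : ‖m‖ < ‖u‖) : 0 < omegaKernel u m := by
  have hsub := norm_sub_pos_of_norm_lt h
  rw [omegaKernel, norm_sub_rev]
  exact div_pos (sq_sub_norm_sq_pos h) (pow_pos hsub 2)

theorem omegaKernel_cpow_eq_exp (h : ‖m‖ < ‖u‖) (α : ℂ) :
    (omegaKernel u m : ℂ) ^ α = Complex.exp (α * (Real.log (omegaKernel u m) : ℝ)) := by
  have hω := omegaKernel_pos h
  rw [Complex.cpow_def_of_ne_zero (Complex.ofReal_ne_zero.2 hω.ne'), Complex.ofReal_log hω.le,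
    mul_comm]

theorem contDiffOn_log_omegaKernel {n : ℕ} :
    ContDiffOn ℝ n (fun q : Eucl k × Eucl k => Real.log (omegaKernel q.1 q.2))
      {q | ‖q.2‖ < ‖q.1‖} := by
  have hω : ContDiffOn ℝ n (fun q : Eucl k × Eucl k => omegaKernel q.1 q.2)
      {q | ‖q.2‖ < ‖q.1‖} :=
    ((contDiff_fst.norm_sq ℝ).sub (contDiff_snd.norm_sq ℝ)).contDiffOn.div
      ((contDiff_fst.sub contDiff_snd).norm_sq ℝ).contDiffOn fun q hq => by
        have hsub := norm_sub_pos_of_norm_lt hq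
        rw [norm_sub_rev]
        positivity
  exact hω.log fun q hq => (omegaKernel_pos hq).ne'

theorem contDiffOn_omegaKernel_cpow (α : ℂ) {n : ℕ} :
    ContDiffOn ℝ n (fun q : Eucl k × Eucl k => (omegaKernel q.1 q.2 : ℂ) ^ α)
      {q | ‖q.2‖ < ‖q.1‖} := by
  have hexp : ContDiffOn ℝ n (fun q : Eucl k × Eucl k => Complex.exp
      (α * (Complex.ofRealCLM (Real.log (omegaKernel q.1 q.2))))) {q | ‖q.2‖ < ‖q.1‖} :=
    (contDiffOn_const.mul (Complex.ofRealCLM.contDiff.comp_contDiffOn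
      contDiffOn_log_omegaKernel)).cexp
  exact hexp.congr fun q hq => omegaKernel_cpow_eq_exp hq α

theorem isOpen_setOf_norm_snd_lt_norm_fst :
    IsOpen {q : Eucl k × Eucl k | ‖q.2‖ < ‖q.1‖} :=
  isOpen_lt (by fun_prop) (by fun_prop)

theorem contDiffAt_log_omegaKernel (h : ‖m‖ < ‖u‖) :
    ContDiffAt ℝ 2 (fun x => Real.log (omegaKernel u x)) m :=
  ((contDiffOn_log_omegaKernel (n := 2)).contDiffAt
    (isOpen_setOf_norm_snd_lt_norm_fst.mem_nhds (show (u, m) ∈ _ from h))).comp m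
    (contDiffAt_const.prodMk contDiffAt_id)

theorem eventually_norm_lt (h : ‖m‖ < ρ) : ∀ᶠ x in 𝓝 m, ‖x‖ < ρ :=
  continuous_norm.continuousAt.eventually_lt_const h

theorem log_omegaKernel_eventuallyEq (h : ‖m‖ < ‖u‖) :
    (fun x => (Real.log (omegaKernel u x) : ℂ)) =ᶠ[𝓝 m] fun x =>
      (Real.log (‖u‖ ^ 2 - ‖x‖ ^ 2) : ℂ) - (Real.log (‖x - u‖ ^ 2) : ℂ) := by
  filter_upwards [eventually_norm_lt h] with x hx
  have hsub := norm_sub_pos_of_norm_lt hx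
  rw [omegaKernel, norm_sub_rev, Real.log_div (sq_sub_norm_sq_pos hx).ne' (by positivity),
    Complex.ofReal_sub]

theorem partialDeriv_log_omegaKernel (h : ‖m‖ < ‖u‖) (i : Fin (k + 1)) :
    partialDeriv i (fun x => (Real.log (omegaKernel u x) : ℂ)) m =
      -(2 / ((‖u‖ : ℂ) ^ 2 - ‖m‖ ^ 2) * m i + 2 / (‖m - u‖ : ℂ) ^ 2 * (m i - u i)) := by
  have hA := sq_sub_norm_sq_pos h
  have hD := pow_pos (norm_sub_pos_of_norm_lt h) 2
  have hdiffA : DifferentiableAt ℝ (fun x => ‖u‖ ^ 2 - ‖x‖ ^ 2) m :=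
    (contDiff_const_sub_norm_sq _).differentiable two_ne_zero m
  have hdiffD : DifferentiableAt ℝ (fun x => ‖x - u‖ ^ 2) m :=
    (contDiff_norm_sub_sq u).differentiable two_ne_zero m
  rw [partialDeriv_congr (log_omegaKernel_eventuallyEq h), partialDeriv_sub
      (F := fun x => (Real.log (‖u‖ ^ 2 - ‖x‖ ^ 2) : ℂ))
      (G := fun x => (Real.log (‖x - u‖ ^ 2) : ℂ))
      ((hasDerivAt_ofReal_log hA).differentiableAt.comp m hdiffA)
      ((hasDerivAt_ofReal_log hD).differentiableAt.comp m hdiffD),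
    partialDeriv_comp (hasDerivAt_ofReal_log hA) hdiffA,
    partialDeriv_comp (hasDerivAt_ofReal_log hD) hdiffD, partialDeriv_norm_sub_sq,
    partialDeriv_const_sub_norm_sq]
  push_cast
  ring

theorem hyperbolicGradSq_log_omegaKernel (h : ‖m‖ < ‖u‖) :
    hyperbolicGradSq k ‖u‖ (fun x => (Real.log (omegaKernel u x) : ℂ)) m = 1 / (‖u‖ : ℂ) ^ 2 := by
  have hu : (‖u‖ : ℂ) ≠ 0 := Complex.ofReal_ne_zero.2 ((norm_nonneg m).trans_lt h).ne'
  have hA : (‖u‖ : ℂ) ^ 2 - ‖m‖ ^ 2 ≠ 0 := by exact_mod_cast (sq_sub_norm_sq_pos h).ne'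
  have hD : (‖m - u‖ : ℂ) ≠ 0 := Complex.ofReal_ne_zero.2 (norm_sub_pos_of_norm_lt h).ne'
  have hterm : ∀ i, partialDeriv i (fun x => (Real.log (omegaKernel u x) : ℂ)) m ^ 2 =
      4 / ((‖u‖ : ℂ) ^ 2 - ‖m‖ ^ 2) ^ 2 * (m i) ^ 2 +
      8 / (((‖u‖ : ℂ) ^ 2 - ‖m‖ ^ 2) * ‖m - u‖ ^ 2) * (m i * (m i - u i)) +
      4 / (‖m - u‖ : ℂ) ^ 4 * (m i - u i) ^ 2 := fun i => by
    rw [partialDeriv_log_omegaKernel h]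
    field_simp
    ring
  simp only [hyperbolicGradSq, hterm, Finset.sum_add_distrib, ← Finset.mul_sum, sum_sq,
    sum_mul_sub, sum_sq_sub, inv_conformalFactor_sq]
  field_simp
  ring

theorem hyperbolicLaplacian_log_omegaKernel (hk : 1 ≤ k) (h : ‖m‖ < ‖u‖) :
    hyperbolicLaplacian k ‖u‖ (fun x => (Real.log (omegaKernel u x) : ℂ)) m =
      -k / (‖u‖ : ℂ) ^ 2 := by
  have hu : (‖u‖ : ℂ) ≠ 0 := Complex.ofReal_ne_zero.2 ((norm_nonneg m).trans_lt h).ne'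
  have hApos := sq_sub_norm_sq_pos h
  have hDpos := pow_pos (norm_sub_pos_of_norm_lt h) 2
  have hA : (‖u‖ : ℂ) ^ 2 - ‖m‖ ^ 2 ≠ 0 := by exact_mod_cast hApos.ne'
  have hD : (‖m - u‖ : ℂ) ≠ 0 := Complex.ofReal_ne_zero.2 (norm_sub_pos_of_norm_lt h).ne'
  have hdiffA := (contDiff_const_sub_norm_sq (k := k) (‖u‖ ^ 2)).contDiffAt (x := m)
  have hdiffD := (contDiff_norm_sub_sq u).contDiffAt (x := m)
  rw [hyperbolicLaplacian_congr (log_omegaKernel_eventuallyEq h), hyperbolicLaplacian_sub hk h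
      (contDiffAt_ofReal_comp (hdiffA.log hApos.ne'))
      (contDiffAt_ofReal_comp (hdiffD.log hDpos.ne')),
    hyperbolicLaplacian_log hk h hdiffA hApos, hyperbolicLaplacian_log hk h hdiffD hDpos,
    hyperbolicGradSq_const_sub_norm_sq, hyperbolicLaplacian_const_sub_norm_sq hk h,
    hyperbolicGradSq_norm_sub_sq, hyperbolicLaplacian_norm_sub_sq hk h, inv_conformalFactor_sq]
  push_cast
  field_simp
  ring

theorem hyperbolicLaplacian_omegaKernel_cpow (hk : 1 ≤ k) (h : ‖m‖ < ‖u‖) (α : ℂ) :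
    hyperbolicLaplacian k ‖u‖ (fun x => (omegaKernel u x : ℂ) ^ α) m =
      (α ^ 2 - α * k) / (‖u‖ : ℂ) ^ 2 * (omegaKernel u m : ℂ) ^ α := by
  have hexp : ∀ t : ℝ, HasDerivAt (fun t : ℝ => Complex.exp (α * t))
      (α * Complex.exp (α * t)) t := fun t => by
    simpa [mul_comm] using ((hasDerivAt_id t).ofReal_comp.const_mul α).cexp
  have hcongr : (fun x => (omegaKernel u x : ℂ) ^ α) =ᶠ[𝓝 m]
      fun x => Complex.exp (α * (Real.log (omegaKernel u x) : ℝ)) :=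
    (eventually_norm_lt h).mono fun x hx => omegaKernel_cpow_eq_exp hx α
  rw [hyperbolicLaplacian_congr hcongr, hyperbolicLaplacian_comp hk h
      (contDiffAt_log_omegaKernel h) (Eventually.of_forall hexp) ((hexp _).const_mul α),
    hyperbolicGradSq_log_omegaKernel h, hyperbolicLaplacian_log_omegaKernel hk h,
    omegaKernel_cpow_eq_exp h]
  ring

end OmegaKernel

section HyperbolicRadius

variable {k : ℕ} {ρ η : ℝ} {m : Eucl k}

theorem hyperbolicRadius_eq_artanh (hη : η ∈ Icc 0 ρ) (hρ : 0 < ρ) :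
    hyperbolicRadius ρ η = ρ * (2 * Real.artanh (η / ρ)) := by
  have hmem : η / ρ ∈ Icc (-1 : ℝ) 1 :=
    ⟨by linarith [div_nonneg hη.1 hρ.le], (div_le_one hρ).2 hη.2⟩
  have hquot : (1 + η / ρ) / (1 - η / ρ) = (ρ + η) / (ρ - η) := by
    rw [← mul_div_mul_left _ _ hρ.ne', mul_add, mul_sub, mul_one, mul_div_cancel₀ _ hρ.ne']
  rw [hyperbolicRadius, Real.artanh_eq_half_log hmem, hquot]
  ring

theorem hyperbolicRadius_pos (hη : η ∈ Ioo 0 ρ) : 0 < hyperbolicRadius ρ η := by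
  have hρ : 0 < ρ := hη.1.trans hη.2
  refine mul_pos hρ (Real.log_pos ?_)
  rw [lt_div_iff₀ (sub_pos.2 hη.2)]
  linarith [hη.1]

theorem hyperbolicRadius_nonneg (hη : η ∈ Ico 0 ρ) : 0 ≤ hyperbolicRadius ρ η := by
  rcases hη.1.eq_or_lt with rfl | hpos
  · simp [hyperbolicRadius, hη.2.ne']
  · exact (hyperbolicRadius_pos ⟨hpos, hη.2⟩).le

theorem abs_tanh (x : ℝ) : |Real.tanh x| = Real.tanh |x| := by
  have hnonneg : ∀ {y : ℝ}, 0 ≤ y → 0 ≤ Real.tanh y := fun hy => by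
    rw [Real.tanh_eq_sinh_div_cosh]
    exact div_nonneg (Real.sinh_nonneg_iff.2 hy) (Real.cosh_pos _).le
  rcases le_total 0 x with hx | hx
  · rw [abs_of_nonneg hx, abs_of_nonneg (hnonneg hx)]
  · rw [abs_of_nonpos hx, ← abs_neg, ← Real.tanh_neg, abs_of_nonneg (hnonneg (neg_nonneg.2 hx))]

/-- The point at signed hyperbolic distance `t` from the origin on the first coordinate axis: this
parametrizes a geodesic through the origin by arc length, inverting `hyperbolicRadius`. -/
noncomputable def axisPoint (k : ℕ) (ρ t : ℝ) : Eucl k :=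
  (ρ * Real.tanh (t / ρ / 2)) • EuclideanSpace.single 0 1

theorem norm_axisPoint (hρ : 0 < ρ) (t : ℝ) :
    ‖axisPoint k ρ t‖ = ρ * Real.tanh (|t| / ρ / 2) := by
  rw [axisPoint, norm_smul, PiLp.norm_single, norm_one, mul_one, norm_mul,
    Real.norm_of_nonneg hρ.le, Real.norm_eq_abs, abs_tanh, abs_div, abs_div, abs_two, abs_of_pos hρ]

theorem norm_axisPoint_lt (hρ : 0 < ρ) (t : ℝ) : ‖axisPoint k ρ t‖ < ρ := by
  rw [norm_axisPoint hρ]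
  exact mul_lt_of_lt_one_right hρ (Real.tanh_lt_one _)

theorem hyperbolicRadius_norm_axisPoint (hρ : 0 < ρ) (t : ℝ) :
    hyperbolicRadius ρ ‖axisPoint k ρ t‖ = |t| := by
  rw [hyperbolicRadius_eq_artanh ⟨norm_nonneg _, (norm_axisPoint_lt hρ t).le⟩ hρ,
    norm_axisPoint hρ, mul_div_cancel_left₀ _ hρ.ne', Real.artanh_tanh,
    mul_div_cancel₀ _ two_ne_zero, mul_div_cancel₀ _ hρ.ne']

theorem norm_axisPoint_hyperbolicRadius (hm : ‖m‖ < ρ) :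
    ‖axisPoint k ρ (hyperbolicRadius ρ ‖m‖)‖ = ‖m‖ := by
  have hρ : 0 < ρ := (norm_nonneg m).trans_lt hm
  have hlt : ‖m‖ / ρ ∈ Ioo (-1) 1 :=
    ⟨by linarith [div_nonneg (norm_nonneg m) hρ.le], (div_lt_one hρ).2 hm⟩
  rw [norm_axisPoint hρ, abs_of_nonneg (hyperbolicRadius_nonneg ⟨norm_nonneg m, hm⟩),
    hyperbolicRadius_eq_artanh ⟨norm_nonneg m, hm.le⟩ hρ, mul_div_cancel_left₀ _ hρ.ne',
    mul_div_cancel_left₀ _ two_ne_zero, Real.tanh_artanh hlt, mul_div_cancel₀ _ hρ.ne']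

theorem contDiff_axisPoint : ContDiff ℝ 2 (axisPoint k ρ) := by
  have htanh : ContDiff ℝ 2 Real.tanh := by
    rw [funext Real.tanh_eq_sinh_div_cosh]
    exact Real.contDiff_sinh.div Real.contDiff_cosh fun x => (Real.cosh_pos x).ne'
  unfold axisPoint
  fun_prop

theorem hasDerivAt_hyperbolicRadius (hη : η ∈ Ioo 0 ρ) :
    HasDerivAt (hyperbolicRadius ρ) (2 * ρ ^ 2 / (ρ ^ 2 - η ^ 2)) η := by
  have hsub : 0 < ρ - η := sub_pos.2 hη.2
  have hadd : 0 < ρ + η := by linarith [hη.1]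
  have hquot := ((hasDerivAt_id η).const_add ρ).fun_div ((hasDerivAt_id η).const_sub ρ) hsub.ne'
  refine ((hquot.log (div_pos hadd hsub).ne').const_mul ρ).congr_deriv ?_
  rw [show ρ ^ 2 - η ^ 2 = (ρ - η) * (ρ + η) by ring]
  simp only [id]
  field_simp
  ring

theorem contDiffAt_hyperbolicRadius_norm (hm₀ : m ≠ 0) (hm : ‖m‖ < ρ) :
    ContDiffAt ℝ 2 (fun x : Eucl k => hyperbolicRadius ρ ‖x‖) m := by
  have hnorm : ContDiffAt ℝ 2 (fun x : Eucl k => ‖x‖) m := contDiffAt_norm ℝ hm₀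
  have hadd : 0 < ρ + ‖m‖ := by linarith [norm_nonneg m]
  exact contDiffAt_const.mul (((contDiffAt_const.add hnorm).div (contDiffAt_const.sub hnorm)
    (sub_pos.2 hm).ne').log (div_pos hadd (sub_pos.2 hm)).ne')

theorem hasDerivAt_hyperbolicRadius_sqrt {s : ℝ} (hs : s ∈ Ioo 0 (ρ ^ 2)) (hρ : 0 < ρ) :
    HasDerivAt (fun s => (hyperbolicRadius ρ √s : ℂ))
      ((ρ ^ 2 / (√s * (ρ ^ 2 - s)) : ℝ) : ℂ) s := by
  have hsqrt : √s ∈ Ioo 0 ρ := ⟨Real.sqrt_pos.2 hs.1, (Real.sqrt_lt' hρ).2 hs.2⟩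
  refine ((hasDerivAt_hyperbolicRadius hsqrt).comp s
    (Real.hasDerivAt_sqrt hs.1.ne')).ofReal_comp.congr_deriv ?_
  have := hsqrt.1
  rw [Real.sq_sqrt hs.1.le]
  congr 1
  field_simp

theorem norm_sq_mem_Ioo (hm₀ : m ≠ 0) (hm : ‖m‖ < ρ) : ‖m‖ ^ 2 ∈ Ioo 0 (ρ ^ 2) :=
  ⟨by positivity, pow_lt_pow_left₀ hm (norm_nonneg m) two_ne_zero⟩

theorem hyperbolicGradSq_hyperbolicRadius (hm₀ : m ≠ 0) (hm : ‖m‖ < ρ) :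
    hyperbolicGradSq k ρ (fun x => (hyperbolicRadius ρ ‖x‖ : ℂ)) m = 1 := by
  have hpos : 0 < ‖m‖ := norm_pos_iff.2 hm₀
  have hρ : 0 < ρ := hpos.trans hm
  have hcomp := hyperbolicGradSq_comp (ρ := ρ) (h := fun x : Eucl k => ‖x - 0‖ ^ 2) (m := m)
    (hasDerivAt_hyperbolicRadius_sqrt (by simpa using norm_sq_mem_Ioo hm₀ hm) hρ)
    ((contDiff_norm_sub_sq 0).differentiable two_ne_zero m)
  rw [hyperbolicGradSq_norm_sub_sq, inv_conformalFactor_sq] at hcomp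
  simp only [sub_zero, Real.sqrt_sq (norm_nonneg _)] at hcomp
  rw [hcomp]
  have hA : (ρ : ℂ) ^ 2 - (‖m‖ : ℂ) ^ 2 ≠ 0 := by exact_mod_cast (sq_sub_norm_sq_pos hm).ne'
  have hm' : (‖m‖ : ℂ) ≠ 0 := by exact_mod_cast hpos.ne'
  have hρ' : (ρ : ℂ) ≠ 0 := by exact_mod_cast hρ.ne'
  push_cast
  field_simp

theorem hasDerivAt_div_sqrt_mul_sub {s : ℝ} (hs : s ∈ Ioo 0 (ρ ^ 2)) :
    HasDerivAt (fun s => ρ ^ 2 / (√s * (ρ ^ 2 - s)))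
      (-(ρ ^ 2 * (ρ ^ 2 - 3 * s)) / (2 * √s ^ 3 * (ρ ^ 2 - s) ^ 2)) s := by
  have hsqrt : 0 < √s := Real.sqrt_pos.2 hs.1
  have hsub : 0 < ρ ^ 2 - s := sub_pos.2 hs.2
  refine ((hasDerivAt_const s (ρ ^ 2)).fun_div ((Real.hasDerivAt_sqrt hs.1.ne').fun_mul
    ((hasDerivAt_id s).const_sub (ρ ^ 2))) (mul_pos hsqrt hsub).ne').congr_deriv ?_
  simp only [id]
  field_simp
  rw [Real.sq_sqrt hs.1.le]
  ring

theorem hyperbolicLaplacian_hyperbolicRadius (hk : 1 ≤ k) (hm₀ : m ≠ 0) (hm : ‖m‖ < ρ) :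
    hyperbolicLaplacian k ρ (fun x => (hyperbolicRadius ρ ‖x‖ : ℂ)) m =
      ((k * (ρ ^ 2 + ‖m‖ ^ 2) / (2 * ρ ^ 2 * ‖m‖) : ℝ) : ℂ) := by
  have hpos : 0 < ‖m‖ := norm_pos_iff.2 hm₀
  have hρ : 0 < ρ := hpos.trans hm
  have hs := norm_sq_mem_Ioo hm₀ hm
  have hcomp := hyperbolicLaplacian_comp (h := fun x : Eucl k => ‖x - 0‖ ^ 2) hk hm
    (contDiff_norm_sub_sq 0).contDiffAt
    (Filter.Eventually.mono (isOpen_Ioo.mem_nhds (by simpa using hs)) fun s hs =>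
      hasDerivAt_hyperbolicRadius_sqrt hs hρ)
    (hasDerivAt_div_sqrt_mul_sub (by simpa using hs)).ofReal_comp
  rw [hyperbolicGradSq_norm_sub_sq, hyperbolicLaplacian_norm_sub_sq hk hm,
    inv_conformalFactor_sq] at hcomp
  simp only [sub_zero, norm_zero, Real.sqrt_sq (norm_nonneg _)] at hcomp
  rw [hcomp]
  have hA : (ρ : ℂ) ^ 2 - (‖m‖ : ℂ) ^ 2 ≠ 0 := by exact_mod_cast (sq_sub_norm_sq_pos hm).ne'
  have hm' : (‖m‖ : ℂ) ≠ 0 := by exact_mod_cast hpos.ne'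
  have hρ' : (ρ : ℂ) ≠ 0 := by exact_mod_cast hρ.ne'
  push_cast
  field_simp
  ring

/-- The mean curvature `(k / ρ) coth (r / ρ)` of the geodesic sphere of radius `r`; it is the value
on that sphere of the Laplacian of the distance to the centre, hence the damping coefficient of the
radial equation. -/
noncomputable def meanCurvature (k : ℕ) (ρ r : ℝ) : ℝ :=
  k / ρ * (Real.cosh (r / ρ) / Real.sinh (r / ρ))

theorem meanCurvature_hyperbolicRadius (hη : η ∈ Ioo 0 ρ) :
    meanCurvature k ρ (hyperbolicRadius ρ η) = k * (ρ ^ 2 + η ^ 2) / (2 * ρ ^ 2 * η) := by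
  have hρ : 0 < ρ := hη.1.trans hη.2
  have hsub : 0 < ρ - η := sub_pos.2 hη.2
  have hadd : 0 < ρ + η := by linarith [hη.1]
  have hη₀ := hη.1
  have hcosh : ((ρ + η) / (ρ - η) + ((ρ + η) / (ρ - η))⁻¹) / 2 =
      (ρ ^ 2 + η ^ 2) / ((ρ - η) * (ρ + η)) := by
    field_simp
    ring
  have hsinh : ((ρ + η) / (ρ - η) - ((ρ + η) / (ρ - η))⁻¹) / 2 =
      2 * ρ * η / ((ρ - η) * (ρ + η)) := by
    field_simp
    ring
  rw [meanCurvature, hyperbolicRadius, mul_div_cancel_left₀ _ hρ.ne',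
    Real.cosh_log (div_pos hadd hsub), Real.sinh_log (div_pos hadd hsub), hcosh, hsinh]
  field_simp

theorem meanCurvature_nonneg (hρ : 0 < ρ) {r : ℝ} (hr : 0 ≤ r) : 0 ≤ meanCurvature k ρ r :=
  mul_nonneg (by positivity)
    (div_nonneg (Real.cosh_pos _).le (Real.sinh_nonneg_iff.2 (div_nonneg hr hρ.le)))

theorem hasDerivAt_meanCurvature (hρ : 0 < ρ) {r : ℝ} (hr : 0 < r) :
    HasDerivAt (meanCurvature k ρ) (-(k / ρ ^ 2 / Real.sinh (r / ρ) ^ 2)) r := by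
  have hsinh : 0 < Real.sinh (r / ρ) := Real.sinh_pos_iff.2 (div_pos hr hρ)
  have hdiv := (hasDerivAt_id r).div_const ρ
  refine ((hdiv.cosh.fun_div hdiv.sinh hsinh.ne').const_mul (k / ρ)).congr_deriv ?_
  simp only [id]
  field_simp
  linear_combination -(k : ℝ) * Real.cosh_sq (r / ρ)

theorem tendsto_sinh_div_atTop (hρ : 0 < ρ) :
    Tendsto (fun r => Real.sinh (r / ρ)) atTop atTop := by
  refine tendsto_atTop_mono' _ ?_ (tendsto_id.atTop_div_const hρ)
  filter_upwards [eventually_ge_atTop 0] with r hr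
    using Real.self_le_sinh_iff.2 (div_nonneg hr hρ.le)

theorem tendsto_meanCurvature (hρ : 0 < ρ) : Tendsto (meanCurvature k ρ) atTop (𝓝 (k / ρ)) := by
  have hexp : Tendsto (fun r => Real.exp (-(r / ρ))) atTop (𝓝 0) :=
    Real.tendsto_exp_neg_atTop_nhds_zero.comp (tendsto_id.atTop_div_const hρ)
  have hcoth : Tendsto (fun r => Real.cosh (r / ρ) / Real.sinh (r / ρ)) atTop (𝓝 1) := by
    have hquot := (hexp.div_atTop (tendsto_sinh_div_atTop hρ)).const_add 1
    rw [add_zero] at hquot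
    refine hquot.congr' ?_
    filter_upwards [eventually_gt_atTop 0] with r hr
    rw [← Real.cosh_sub_sinh, sub_div, div_self (Real.sinh_pos_iff.2 (div_pos hr hρ)).ne',
      add_sub_cancel]
  simpa only [mul_one] using! hcoth.const_mul (k / ρ : ℝ)

theorem tendsto_deriv_meanCurvature (hρ : 0 < ρ) :
    Tendsto (fun r => -(k / ρ ^ 2 / Real.sinh (r / ρ) ^ 2)) atTop (𝓝 0) := by
  simpa using ((tendsto_pow_atTop two_ne_zero).comp
    (tendsto_sinh_div_atTop hρ)).const_div_atTop (k / ρ ^ 2 : ℝ) |>.neg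

end HyperbolicRadius

section MeanKernel

variable {k : ℕ} {ρ : ℝ} {m m' : Eucl k}

/-- The mean of `ω(u, m) ^ α` over all `u` with `|u| = ρ`. Averaging over the boundary variable `u`
instead of the interior one makes this an eigenfunction by differentiation under the integral. -/
noncomputable def meanKernel (k : ℕ) (ρ : ℝ) (α : ℂ) (m : Eucl k) : ℂ :=
  ∫ s : Metric.sphere (0 : Eucl k) 1, (omegaKernel (ρ • (s : Eucl k)) m : ℂ) ^ α ∂unitSphereProb k

theorem norm_smul_coe_sphere (hρ : 0 < ρ) (s : Metric.sphere (0 : Eucl k) 1) :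
    ‖ρ • (s : Eucl k)‖ = ρ := by
  rw [norm_smul, norm_eq_of_mem_sphere s, mul_one, Real.norm_of_nonneg hρ.le]

theorem norm_lt_norm_smul_coe_sphere (hρ : 0 < ρ) (s : Metric.sphere (0 : Eucl k) 1)
    (hm : m ∈ Metric.ball (0 : Eucl k) ρ) : ‖m‖ < ‖ρ • (s : Eucl k)‖ := by
  rwa [norm_smul_coe_sphere hρ, ← mem_ball_zero_iff]

theorem omegaKernel_smul_coe_sphere_pos (hρ : 0 < ρ) (s : Metric.sphere (0 : Eucl k) 1)
    (hm : m ∈ Metric.ball (0 : Eucl k) ρ) : 0 < omegaKernel (ρ • (s : Eucl k)) m :=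
  omegaKernel_pos (norm_lt_norm_smul_coe_sphere hρ s hm)

theorem contDiffOn_meanKernel (hρ : 0 < ρ) (α : ℂ) :
    ContDiffOn ℝ 2 (meanKernel k ρ α) (Metric.ball 0 ρ) :=
  contDiffOn_integral_comp (n := 2) (c := fun s : Metric.sphere (0 : Eucl k) 1 => ρ • (s : Eucl k))
    (by fun_prop) Metric.isOpen_ball isOpen_setOf_norm_snd_lt_norm_fst
    (fun s _ => norm_lt_norm_smul_coe_sphere hρ s) (contDiffOn_omegaKernel_cpow α)

theorem hyperbolicLaplacian_meanKernel (hk : 1 ≤ k) (hρ : 0 < ρ) (α : ℂ)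
    (hm : m ∈ Metric.ball (0 : Eucl k) ρ) :
    hyperbolicLaplacian k ρ (meanKernel k ρ α) m =
      (α ^ 2 - α * k) / (ρ : ℂ) ^ 2 * meanKernel k ρ α m := by
  refine (hyperbolicLaplacian_integral hk
    (c := fun s : Metric.sphere (0 : Eucl k) 1 => ρ • (s : Eucl k)) (by fun_prop)
    isOpen_setOf_norm_snd_lt_norm_fst (fun s _ => norm_lt_norm_smul_coe_sphere hρ s)
    (contDiffOn_omegaKernel_cpow α) hm).trans ?_
  rw [meanKernel, ← integral_const_mul]
  refine integral_congr_ae (Eventually.of_forall fun s => ?_)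
  simpa only [norm_smul_coe_sphere hρ] using
    hyperbolicLaplacian_omegaKernel_cpow hk (norm_lt_norm_smul_coe_sphere hρ s hm) α

theorem meanKernel_zero (hρ : 0 < ρ) (α : ℂ) : meanKernel k ρ α 0 = 1 := by
  have hone : ∀ s : Metric.sphere (0 : Eucl k) 1, omegaKernel (ρ • (s : Eucl k)) 0 = 1 :=
    fun s => by
      rw [omegaKernel, sub_zero, norm_smul_coe_sphere hρ, norm_zero, zero_pow two_ne_zero, sub_zero,
        div_self (pow_pos hρ 2).ne']
  simp [meanKernel, hone]

theorem meanKernel_eq_sphereMean (hρ : 0 < ρ) (α : ℂ) {η : ℝ} (hη : 0 < η) {u : Eucl k}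
    (hu : ‖u‖ = ρ) (hm : ‖m‖ = η) :
    meanKernel k ρ α m = sphereMean k η fun x => (omegaKernel u x : ℂ) ^ α :=
  integral_omegaKernel_eq_sphereMean hρ hη hu hm fun t => (t : ℂ) ^ α

theorem meanKernel_congr_norm (α : ℂ) (h : ‖m‖ = ‖m'‖) :
    meanKernel k ρ α m = meanKernel k ρ α m' := by
  obtain ⟨e, rfl⟩ := exists_linearIsometryEquiv_apply_eq h
  rw [meanKernel, meanKernel,
    ← integral_unitSphereProb_comp e fun x => (omegaKernel (ρ • x) (e m) : ℂ) ^ α]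
  simp only [← map_smul, omegaKernel_map]

theorem integrable_omegaKernel_cpow (hρ : 0 < ρ) (α : ℂ) (hm : m ∈ Metric.ball (0 : Eucl k) ρ) :
    Integrable (fun s : Metric.sphere (0 : Eucl k) 1 => (omegaKernel (ρ • (s : Eucl k)) m : ℂ) ^ α)
      (unitSphereProb k) :=
  integrable_comp_prodMk (c := fun s : Metric.sphere (0 : Eucl k) 1 => ρ • (s : Eucl k))
    (by fun_prop) (fun s _ => norm_lt_norm_smul_coe_sphere hρ s)
    (contDiffOn_omegaKernel_cpow (n := 0) α).continuousOn hm

theorem meanKernel_ofReal_ne_zero (hρ : 0 < ρ) (a : ℝ) (hm : m ∈ Metric.ball (0 : Eucl k) ρ) :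
    meanKernel k ρ (a : ℂ) m ≠ 0 := by
  have hpos := fun s => Real.rpow_pos_of_pos (omegaKernel_smul_coe_sphere_pos hρ s hm) a
  have hcpow : ∀ s : Metric.sphere (0 : Eucl k) 1,
      (omegaKernel (ρ • (s : Eucl k)) m : ℂ) ^ (a : ℂ) =
        ((omegaKernel (ρ • (s : Eucl k)) m ^ a : ℝ) : ℂ) := fun s =>
    (Complex.ofReal_cpow (omegaKernel_smul_coe_sphere_pos hρ s hm).le a).symm
  have hint : Integrable (fun s : Metric.sphere (0 : Eucl k) 1 =>
      omegaKernel (ρ • (s : Eucl k)) m ^ a) (unitSphereProb k) := by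
    simpa only [hcpow, RCLike.re_to_complex, Complex.ofReal_re] using
      (integrable_omegaKernel_cpow hρ (a : ℂ) hm).re
  have hsupp : Function.support (fun s : Metric.sphere (0 : Eucl k) 1 =>
      omegaKernel (ρ • (s : Eucl k)) m ^ a) = univ := eq_univ_of_forall fun s => (hpos s).ne'
  have hint_pos : 0 < ∫ s : Metric.sphere (0 : Eucl k) 1,
      omegaKernel (ρ • (s : Eucl k)) m ^ a ∂unitSphereProb k := by
    rw [integral_pos_iff_support_of_nonneg (fun s => (hpos s).le) hint, hsupp, measure_univ]
    exact one_pos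
  simp only [meanKernel, hcpow]
  rw [integral_complex_ofReal]
  exact_mod_cast hint_pos.ne'

/-- The radial profile of `meanKernel`, as a function of the hyperbolic distance to the origin. -/
noncomputable def meanKernelProfile (k : ℕ) (ρ : ℝ) (α : ℂ) (r : ℝ) : ℂ :=
  meanKernel k ρ α (axisPoint k ρ r)

theorem meanKernelProfile_hyperbolicRadius (α : ℂ) (hm : m ∈ Metric.ball (0 : Eucl k) ρ) :
    meanKernelProfile k ρ α (hyperbolicRadius ρ ‖m‖) = meanKernel k ρ α m :=
  meanKernel_congr_norm α (norm_axisPoint_hyperbolicRadius (mem_ball_zero_iff.1 hm))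

theorem isNormalizedRadialEigenfunction_meanKernelProfile (hk : 1 ≤ k) (hρ : 0 < ρ) {α μ : ℂ}
    (hα : α * k - α ^ 2 = μ * (ρ : ℂ) ^ 2) :
    IsNormalizedRadialEigenfunction k ρ μ (meanKernelProfile k ρ α) where
  contDiffOn := (contDiffOn_meanKernel hρ α).congr fun _ =>
    meanKernelProfile_hyperbolicRadius α
  eigen m hm := by
    have hρ' : (ρ : ℂ) ≠ 0 := by exact_mod_cast hρ.ne'
    rw [hyperbolicLaplacian_congr (eventuallyEq_of_mem (Metric.isOpen_ball.mem_nhds hm) fun _ =>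
      meanKernelProfile_hyperbolicRadius α), meanKernelProfile_hyperbolicRadius α hm,
      hyperbolicLaplacian_meanKernel hk hρ α hm]
    field_simp
    linear_combination -(meanKernel k ρ α m) * hα
  at_origin := by
    simpa [meanKernelProfile, axisPoint] using meanKernel_zero hρ α

end MeanKernel

namespace IsNormalizedRadialEigenfunction

variable {k : ℕ} {ρ lam : ℝ} {μ : ℂ} {φ ψ : ℝ → ℂ}

theorem contDiff_comp_abs (h : IsNormalizedRadialEigenfunction k ρ μ φ) (hρ : 0 < ρ) :
    ContDiff ℝ 2 fun t => φ |t| := by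
  have hcomp : ContDiff ℝ 2
      ((fun m : Eucl k => φ (hyperbolicRadius ρ ‖m‖)) ∘ axisPoint k ρ) :=
    contDiffOn_univ.1 (h.contDiffOn.comp contDiff_axisPoint.contDiffOn fun t _ =>
      mem_ball_zero_iff.2 (norm_axisPoint_lt hρ t))
  simpa only [Function.comp_def, hyperbolicRadius_norm_axisPoint hρ] using hcomp

theorem hasDerivAt_comp_abs (h : IsNormalizedRadialEigenfunction k ρ μ φ) (hρ : 0 < ρ) (t : ℝ) :
    HasDerivAt (fun t => φ |t|) (deriv (fun t => φ |t|) t) t :=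
  ((h.contDiff_comp_abs hρ).differentiable two_ne_zero t).hasDerivAt

theorem hasDerivAt_deriv_comp_abs (h : IsNormalizedRadialEigenfunction k ρ μ φ) (hρ : 0 < ρ)
    (t : ℝ) :
    HasDerivAt (deriv fun t => φ |t|) (deriv (deriv fun t => φ |t|) t) t :=
  (((contDiff_succ_iff_deriv (n := 1)).1 (h.contDiff_comp_abs hρ)).2.2.differentiable
    one_ne_zero t).hasDerivAt

theorem deriv_comp_abs_zero (φ : ℝ → ℂ) : deriv (fun t => φ |t|) 0 = 0 := by
  have heven := deriv_comp_neg (fun t => φ |t|) 0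
  simp only [abs_neg, neg_zero] at heven
  exact self_eq_neg.1 heven

-- The hyperbolic Laplacian of a function of the distance `r` is `f'' |∇r|² + f' Δr`.
theorem deriv_deriv_comp_abs (h : IsNormalizedRadialEigenfunction k ρ lam φ) (hk : 1 ≤ k)
    (hρ : 0 < ρ) {r : ℝ} (hr : 0 < r) :
    deriv (deriv fun t => φ |t|) r =
      -(meanCurvature k ρ r • deriv (fun t => φ |t|) r) - lam • φ |r| := by
  set m := axisPoint k ρ r
  have hm : ‖m‖ < ρ := norm_axisPoint_lt hρ r
  have hmr : hyperbolicRadius ρ ‖m‖ = r := by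
    rw [hyperbolicRadius_norm_axisPoint hρ, abs_of_pos hr]
  have hm₀ : m ≠ 0 := fun h0 => by simp [h0, hyperbolicRadius, hρ.ne', hr.ne] at hmr
  have hradial : (fun x : Eucl k => φ (hyperbolicRadius ρ ‖x‖)) =ᶠ[𝓝 m]
      fun x => φ |hyperbolicRadius ρ ‖x‖| := by
    filter_upwards [Metric.isOpen_ball.mem_nhds (mem_ball_zero_iff.2 hm)] with x hx
    rw [abs_of_nonneg (hyperbolicRadius_nonneg ⟨norm_nonneg x, mem_ball_zero_iff.1 hx⟩)]
  have heigen := h.eigen m (mem_ball_zero_iff.2 hm)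
  rw [hyperbolicLaplacian_congr hradial, hyperbolicLaplacian_comp (g := fun t => φ |t|) hk hm
    (contDiffAt_hyperbolicRadius_norm hm₀ hm)
    (Eventually.of_forall (h.hasDerivAt_comp_abs hρ)) (h.hasDerivAt_deriv_comp_abs hρ _),
    hyperbolicGradSq_hyperbolicRadius hm₀ hm, hyperbolicLaplacian_hyperbolicRadius hk hm₀ hm,
    ← meanCurvature_hyperbolicRadius ⟨norm_pos_iff.2 hm₀, hm⟩, hmr] at heigen
  rw [abs_of_pos hr, Complex.real_smul, Complex.real_smul]
  linear_combination heigen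

theorem solvesDampedODE (h : IsNormalizedRadialEigenfunction k ρ lam φ) (hk : 1 ≤ k)
    (hρ : 0 < ρ) :
    SolvesDampedODE (meanCurvature k ρ) lam (fun t => φ |t|) (deriv fun t => φ |t|) where
  hasDerivAt_fst t _ := h.hasDerivAt_comp_abs hρ t
  hasDerivAt_snd t ht :=
    (h.hasDerivAt_deriv_comp_abs hρ t).congr_deriv (h.deriv_deriv_comp_abs hk hρ ht)

theorem tendsto_nhdsGT_zero (h : IsNormalizedRadialEigenfunction k ρ μ φ) (hρ : 0 < ρ) :
    Tendsto (fun t => φ |t|) (𝓝[>] 0) (𝓝 1) := by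
  have hcont := (h.hasDerivAt_comp_abs hρ 0).continuousAt.tendsto
  rw [abs_zero, h.at_origin] at hcont
  exact hcont.mono_left nhdsWithin_le_nhds

theorem tendsto_deriv_nhdsGT_zero (h : IsNormalizedRadialEigenfunction k ρ μ φ) (hρ : 0 < ρ) :
    Tendsto (deriv fun t => φ |t|) (𝓝[>] 0) (𝓝 0) := by
  have hcont := (h.hasDerivAt_deriv_comp_abs hρ 0).continuousAt.tendsto
  rw [deriv_comp_abs_zero] at hcont
  exact hcont.mono_left nhdsWithin_le_nhds

theorem eqOn (h : IsNormalizedRadialEigenfunction k ρ lam φ)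
    (h' : IsNormalizedRadialEigenfunction k ρ lam ψ) (hk : 1 ≤ k) (hρ : 0 < ρ) :
    EqOn φ ψ (Ici 0) := by
  intro r hr
  rcases (mem_Ici.1 hr).eq_or_lt with rfl | hpos
  · rw [h.at_origin, h'.at_origin]
  · have hzero := ((h.solvesDampedODE hk hρ).sub (h'.solvesDampedODE hk hρ)).eq_zero_of_tendsto
      (fun t ht => meanCurvature_nonneg hρ ht.le)
      (by simpa using (h.tendsto_nhdsGT_zero hρ).sub (h'.tendsto_nhdsGT_zero hρ))
      (by simpa using (h.tendsto_deriv_nhdsGT_zero hρ).sub (h'.tendsto_deriv_nhdsGT_zero hρ)) hpos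
    simpa only [abs_of_pos hpos, sub_eq_zero] using hzero

theorem im_eq_zero (h : IsNormalizedRadialEigenfunction k ρ lam φ) (hk : 1 ≤ k) (hρ : 0 < ρ)
    {r : ℝ} (hr : 0 ≤ r) : (φ r).im = 0 := by
  rcases hr.eq_or_lt with rfl | hpos
  · rw [h.at_origin, Complex.one_im]
  · have hzero := ((h.solvesDampedODE hk hρ).map Complex.imCLM).eq_zero_of_tendsto
      (fun t ht => meanCurvature_nonneg hρ ht.le)
      ((Complex.continuous_im.tendsto 1).comp (h.tendsto_nhdsGT_zero hρ))
      ((Complex.continuous_im.tendsto 0).comp (h.tendsto_deriv_nhdsGT_zero hρ)) hpos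
    simpa only [abs_of_pos hpos, Complex.imCLM_apply] using hzero

theorem eq_zero_iff_re (h : IsNormalizedRadialEigenfunction k ρ lam φ) (hk : 1 ≤ k) (hρ : 0 < ρ)
    {r : ℝ} (hr : 0 ≤ r) : φ r = 0 ↔ (φ r).re = 0 :=
  ⟨fun hz => by rw [hz, Complex.zero_re], fun hz => Complex.ext hz (h.im_eq_zero hk hρ hr)⟩

theorem eq_meanKernel_axisPoint (h : IsNormalizedRadialEigenfunction k ρ lam φ) (hk : 1 ≤ k)
    (hρ : 0 < ρ) {α : ℂ} (hα : α * k - α ^ 2 = lam * (ρ : ℂ) ^ 2) {r : ℝ} (hr : 0 ≤ r) :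
    φ r = meanKernel k ρ α (axisPoint k ρ r) :=
  h.eqOn (isNormalizedRadialEigenfunction_meanKernelProfile hk hρ hα) hk hρ hr

end IsNormalizedRadialEigenfunction

namespace IsNormalizedRadialEigenfunction

variable {k : ℕ} {ρ lam : ℝ} {φ : ℝ → ℂ}

-- Below the threshold the exponent can be taken real, and then `ω ^ α` is positive.
theorem ne_zero_of_le (h : IsNormalizedRadialEigenfunction k ρ lam φ) (hk : 1 ≤ k) (hρ : 0 < ρ)
    (hlam : lam ≤ (k / ρ) ^ 2 / 4) {r : ℝ} (hr : 0 ≤ r) : φ r ≠ 0 := by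
  set a : ℝ := k / 2 + √((k : ℝ) ^ 2 / 4 - lam * ρ ^ 2) with ha
  have hdisc : 0 ≤ (k : ℝ) ^ 2 / 4 - lam * ρ ^ 2 := by
    rw [div_pow, div_right_comm, le_div_iff₀ (pow_pos hρ 2)] at hlam
    exact sub_nonneg.2 hlam
  have hexp : a * k - a ^ 2 = lam * ρ ^ 2 := by
    rw [ha]
    linear_combination -Real.sq_sqrt hdisc
  rw [h.eq_meanKernel_axisPoint hk hρ (α := a) (by exact_mod_cast hexp) hr]
  exact meanKernel_ofReal_ne_zero hρ a (mem_ball_zero_iff.2 (norm_axisPoint_lt hρ r))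

theorem solvesDampedODE_re (h : IsNormalizedRadialEigenfunction k ρ lam φ) (hk : 1 ≤ k)
    (hρ : 0 < ρ) :
    SolvesDampedODE (meanCurvature k ρ) lam (fun t => (φ |t|).re)
      (fun t => (deriv (fun t => φ |t|) t).re) :=
  (h.solvesDampedODE hk hρ).map Complex.reCLM

theorem exists_pos_re_ne_zero (h : IsNormalizedRadialEigenfunction k ρ lam φ) (hρ : 0 < ρ) :
    ∃ t, 0 < t ∧ (φ |t|).re ≠ 0 := by
  have hre : Tendsto (fun t => (φ |t|).re) (𝓝[>] 0) (𝓝 1) :=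
    (Complex.continuous_re.tendsto 1).comp (h.tendsto_nhdsGT_zero hρ)
  obtain ⟨t, hne, ht⟩ := ((hre.eventually_ne one_ne_zero).and self_mem_nhdsWithin).exists
  exact ⟨t, ht, hne⟩

theorem exists_sign_changes (h : IsNormalizedRadialEigenfunction k ρ lam φ) (hk : 1 ≤ k)
    (hρ : 0 < ρ) (hlam : (k / ρ) ^ 2 / 4 < lam) (R : ℝ) :
    ∃ r₁ r₂ : ℝ, R < r₁ ∧ R < r₂ ∧ (φ r₁).re < 0 ∧ 0 < (φ r₂).re := by
  have hode := h.solvesDampedODE_re hk hρ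
  obtain ⟨t, ht, hne⟩ := h.exists_pos_re_ne_zero hρ
  obtain ⟨r₁, hr₁, hneg⟩ := hode.exists_neg (fun _ => hasDerivAt_meanCurvature hρ)
    (tendsto_meanCurvature hρ) (tendsto_deriv_meanCurvature hρ) hlam ⟨t, ht, hne⟩ (max R 0)
  obtain ⟨r₂, hr₂, hpos⟩ := hode.neg.exists_neg (fun _ => hasDerivAt_meanCurvature hρ)
    (tendsto_meanCurvature hρ) (tendsto_deriv_meanCurvature hρ) hlam
    ⟨t, ht, neg_ne_zero.2 hne⟩ (max R 0)
  rw [max_lt_iff] at hr₁ hr₂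
  rw [abs_of_pos hr₁.2] at hneg
  rw [neg_lt_zero, abs_of_pos hr₂.2] at hpos
  exact ⟨r₁, r₂, hr₁.1, hr₂.1, hneg, hpos⟩

theorem exists_eq_zero (h : IsNormalizedRadialEigenfunction k ρ lam φ) (hk : 1 ≤ k)
    (hρ : 0 < ρ) (hlam : (k / ρ) ^ 2 / 4 < lam) : ∃ r : ℝ, 0 ≤ r ∧ φ r = 0 := by
  obtain ⟨r₁, r₂, hr₁, hr₂, hneg, hpos⟩ := h.exists_sign_changes hk hρ hlam 0
  have hcont : Continuous fun t => (φ |t|).re :=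
    Complex.continuous_re.comp (h.contDiff_comp_abs hρ).continuous
  obtain ⟨r, hr⟩ : (0 : ℝ) ∈ range fun t => (φ |t|).re :=
    mem_range_of_exists_le_of_exists_ge hcont
      ⟨r₁, by rw [abs_of_pos hr₁]; exact hneg.le⟩ ⟨r₂, by rw [abs_of_pos hr₂]; exact hpos.le⟩
  exact ⟨|r|, abs_nonneg r, (h.eq_zero_iff_re hk hρ (abs_nonneg r)).2 hr⟩

theorem exists_eq_zero_iff (h : IsNormalizedRadialEigenfunction k ρ lam φ) (hk : 1 ≤ k)
    (hρ : 0 < ρ) : (∃ r : ℝ, 0 ≤ r ∧ φ r = 0) ↔ (k / ρ) ^ 2 / 4 < lam :=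
  ⟨fun ⟨_, hr, hzero⟩ => lt_of_not_ge fun hle => h.ne_zero_of_le hk hρ hle hr hzero,
    h.exists_eq_zero hk hρ⟩

theorem tendsto_atTop_zero (h : IsNormalizedRadialEigenfunction k ρ lam φ) (hk : 1 ≤ k)
    (hρ : 0 < ρ) (hlam : 0 < lam) : Tendsto φ atTop (𝓝 0) := by
  have hcurv : 0 < k / ρ := div_pos (by exact_mod_cast hk) hρ
  refine ((h.solvesDampedODE hk hρ).tendsto_zero (tendsto_meanCurvature hρ) hcurv hlam).congr' ?_
  filter_upwards [eventually_ge_atTop 0] with r hr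
  rw [abs_of_nonneg hr]

theorem exists_zero_spacing (h : IsNormalizedRadialEigenfunction k ρ lam φ) (hk : 1 ≤ k)
    (hρ : 0 < ρ) (hlam : (k / ρ) ^ 2 / 4 < lam) :
    ∃ T₁ T₂ N : ℝ, 0 < T₁ ∧ 0 < T₂ ∧ 0 < N ∧
      ∀ r₁ r₂ : ℝ, N < r₁ → r₁ < r₂ → φ r₁ = 0 → φ r₂ = 0 →
        (∀ r ∈ Ioo r₁ r₂, φ r ≠ 0) → T₁ < |r₂ - r₁| ∧ |r₂ - r₁| < T₂ := by
  obtain ⟨T₁, T₂, N, hT₁, hT₂, hN, hspacing⟩ :=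
    (h.solvesDampedODE_re hk hρ).exists_zero_spacing (fun _ => hasDerivAt_meanCurvature hρ)
      (tendsto_meanCurvature hρ) (tendsto_deriv_meanCurvature hρ) hlam
  refine ⟨T₁, T₂, N, hT₁, hT₂, hN, fun r₁ r₂ hr₁ hr hzero₁ hzero₂ hne => ?_⟩
  have hpos₁ : 0 < r₁ := hN.trans hr₁
  have hre : ∀ r, 0 < r → ((φ |r|).re = 0 ↔ φ r = 0) := fun r hr => by
    rw [abs_of_pos hr, h.eq_zero_iff_re hk hρ hr.le]
  rw [abs_of_pos (sub_pos.2 hr)]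
  exact hspacing r₁ r₂ hr₁ hr ((hre r₁ hpos₁).2 hzero₁) ((hre r₂ (hpos₁.trans hr)).2 hzero₂)
    fun r hmem => (hre r (hpos₁.trans hmem.1)).not.2 (hne r hmem)

end IsNormalizedRadialEigenfunction

section Exponent

variable {k : ℕ} {ρ lam : ℝ}

theorem exponent_mul_sub_sq_eq_iff {b : ℝ} :
    ((k : ℂ) / 2 + Complex.I * b) * k - ((k : ℂ) / 2 + Complex.I * b) ^ 2 =
      lam * (ρ : ℂ) ^ 2 ↔ (k : ℝ) ^ 2 / 4 + b ^ 2 = lam * ρ ^ 2 := by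
  rw [← Complex.ofReal_inj]
  push_cast
  rw [show ((k : ℂ) / 2 + Complex.I * b) * k - ((k : ℂ) / 2 + Complex.I * b) ^ 2 =
    (k : ℂ) ^ 2 / 4 + (b : ℂ) ^ 2 by linear_combination -(b : ℂ) ^ 2 * Complex.I_sq]

theorem exists_mul_sub_sq_eq (a c : ℂ) : ∃ α : ℂ, α * a - α ^ 2 = c := by
  obtain ⟨d, hd⟩ := IsAlgClosed.exists_pow_nat_eq (a ^ 2 / 4 - c) two_pos
  exact ⟨a / 2 + d, by linear_combination -hd⟩

theorem sq_div_four_lt_iff (hρ : 0 < ρ) :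
    ((k : ℝ) / ρ) ^ 2 / 4 < lam ↔ (k : ℝ) ^ 2 / 4 < lam * ρ ^ 2 := by
  rw [div_pow, div_right_comm, div_lt_iff₀ (pow_pos hρ 2)]

theorem exists_exponent_iff (hρ : 0 < ρ) :
    ((k : ℝ) / ρ) ^ 2 / 4 < lam ↔
      ∃ (α : ℂ) (b : ℝ), (lam : ℂ) = (α * (k : ℂ) - α ^ 2) / (ρ : ℂ) ^ 2 ∧
        α = (k : ℂ) / 2 + Complex.I * (b : ℂ) ∧ b ≠ 0 := by
  have hρ' : (ρ : ℂ) ^ 2 ≠ 0 := by exact_mod_cast (pow_pos hρ 2).ne'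
  have hexponent : ∀ b : ℝ, (lam : ℂ) = (((k : ℂ) / 2 + Complex.I * b) * k -
      ((k : ℂ) / 2 + Complex.I * b) ^ 2) / (ρ : ℂ) ^ 2 ↔
        (k : ℝ) ^ 2 / 4 + b ^ 2 = lam * ρ ^ 2 := fun b => by
    rw [eq_div_iff hρ', eq_comm, exponent_mul_sub_sq_eq_iff]
  rw [sq_div_four_lt_iff hρ]
  constructor
  · intro hlam
    refine ⟨_, √(lam * ρ ^ 2 - (k : ℝ) ^ 2 / 4), (hexponent _).2 ?_, rfl,
      (Real.sqrt_pos.2 (sub_pos.2 hlam)).ne'⟩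
    rw [Real.sq_sqrt (sub_pos.2 hlam).le, add_sub_cancel]
  · rintro ⟨_, b, hα, rfl, hb⟩
    rw [← (hexponent b).1 hα]
    exact lt_add_of_pos_right _ (sq_pos_of_ne_zero hb)

theorem exists_isNormalizedRadialEigenfunction (hk : 1 ≤ k) (hρ : 0 < ρ) (μ : ℂ) :
    ∃ φ : ℝ → ℂ, IsNormalizedRadialEigenfunction k ρ μ φ :=
  let ⟨_, hα⟩ := exists_mul_sub_sq_eq k (μ * (ρ : ℂ) ^ 2)
  ⟨_, isNormalizedRadialEigenfunction_meanKernelProfile hk hρ hα⟩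

end Exponent

theorem re_ofReal_cpow_add_I_mul {x : ℝ} (hx : 0 < x) (a b : ℝ) :
    ((x : ℂ) ^ ((a : ℂ) + Complex.I * b)).re = x ^ a * Real.cos (b * Real.log x) := by
  rw [Complex.cpow_def_of_ne_zero (by exact_mod_cast hx.ne'), ← Complex.ofReal_log hx.le,
    Complex.exp_re, Real.rpow_def_of_pos hx]
  simp [mul_comm]

theorem omegaKernel_eq_cos_angle {k : ℕ} (u m : Eucl k) :
    omegaKernel u m = (‖u‖ ^ 2 - ‖m‖ ^ 2) / (‖u‖ ^ 2 + ‖m‖ ^ 2 +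
      2 * ‖m‖ * ‖u‖ * Real.cos (Real.pi - InnerProductGeometry.angle u m)) := by
  rw [omegaKernel, norm_sub_sq_real, ← InnerProductGeometry.cos_angle_mul_norm_mul_norm,
    Real.cos_pi_sub]
  ring_nf

namespace IsNormalizedRadialEigenfunction

variable {k : ℕ} {ρ lam η b : ℝ} {φ : ℝ → ℂ} {u : Eucl k}

theorem eq_meanKernel (h : IsNormalizedRadialEigenfunction k ρ lam φ) (hk : 1 ≤ k)
    (hρ : 0 < ρ) {α : ℂ} (hα : α * k - α ^ 2 = lam * (ρ : ℂ) ^ 2) {m : Eucl k} (hm : ‖m‖ < ρ) :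
    φ (hyperbolicRadius ρ ‖m‖) = meanKernel k ρ α m :=
  (h.eq_meanKernel_axisPoint hk hρ hα (hyperbolicRadius_nonneg ⟨norm_nonneg m, hm⟩)).trans
    (meanKernelProfile_hyperbolicRadius α (mem_ball_zero_iff.2 hm))

theorem eq_sphereMean (h : IsNormalizedRadialEigenfunction k ρ lam φ) (hk : 1 ≤ k) (hρ : 0 < ρ)
    {α : ℂ} (hα : α * k - α ^ 2 = lam * (ρ : ℂ) ^ 2) (hη : η ∈ Ioo 0 ρ) (hu : ‖u‖ = ρ) :
    φ (hyperbolicRadius ρ η) = sphereMean k η fun m => (omegaKernel u m : ℂ) ^ α := by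
  obtain ⟨m, hm⟩ := exists_norm_eq (Eucl k) hη.1.le
  rw [← meanKernel_eq_sphereMean hρ α hη.1 hu hm, ← h.eq_meanKernel hk hρ hα (hm ▸ hη.2), hm]

theorem eq_sphereMean_add_I_mul (h : IsNormalizedRadialEigenfunction k ρ lam φ) (hk : 1 ≤ k)
    (hρ : 0 < ρ) (hb : (k : ℝ) ^ 2 / 4 + b ^ 2 = lam * ρ ^ 2) (hη : η ∈ Ioo 0 ρ) (hu : ‖u‖ = ρ) :
    φ (hyperbolicRadius ρ η) = sphereMean k η fun m =>
      (omegaKernel u m : ℂ) ^ ((k : ℂ) / 2 + Complex.I * b) :=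
  h.eq_sphereMean hk hρ (exponent_mul_sub_sq_eq_iff.2 hb) hη hu

theorem eq_sphereMean_sub_I_mul (h : IsNormalizedRadialEigenfunction k ρ lam φ) (hk : 1 ≤ k)
    (hρ : 0 < ρ) (hb : (k : ℝ) ^ 2 / 4 + b ^ 2 = lam * ρ ^ 2) (hη : η ∈ Ioo 0 ρ) (hu : ‖u‖ = ρ) :
    φ (hyperbolicRadius ρ η) = sphereMean k η fun m =>
      (omegaKernel u m : ℂ) ^ ((k : ℂ) / 2 - Complex.I * b) := by
  have hneg := h.eq_sphereMean_add_I_mul hk hρ (b := -b) (by rwa [neg_sq]) hη hu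
  simpa only [Complex.ofReal_neg, mul_neg, ← sub_eq_add_neg] using hneg

theorem eq_sphereMean_cos (h : IsNormalizedRadialEigenfunction k ρ lam φ) (hk : 1 ≤ k)
    (hρ : 0 < ρ) (hb : (k : ℝ) ^ 2 / 4 + b ^ 2 = lam * ρ ^ 2) (hη : η ∈ Ioo 0 ρ) (hu : ‖u‖ = ρ) :
    φ (hyperbolicRadius ρ η) = ((sphereMean k η fun m =>
      omegaKernel u m ^ ((k : ℝ) / 2) * Real.cos (b * Real.log (omegaKernel u m)) : ℝ) : ℂ) := by
  obtain ⟨m, hm⟩ := exists_norm_eq (Eucl k) hη.1.le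
  have hmball : m ∈ Metric.ball (0 : Eucl k) ρ := mem_ball_zero_iff.2 (hm ▸ hη.2)
  refine Complex.ext ?_ (h.im_eq_zero hk hρ (hyperbolicRadius_nonneg ⟨hη.1.le, hη.2⟩))
  rw [← hm, h.eq_meanKernel hk hρ (exponent_mul_sub_sq_eq_iff.2 hb) (hm ▸ hη.2), hm,
    ← integral_omegaKernel_eq_sphereMean hρ hη.1 hu hm
      fun t => t ^ ((k : ℝ) / 2) * Real.cos (b * Real.log t), meanKernel, Complex.ofReal_re]
  refine (integral_re (integrable_omegaKernel_cpow hρ _ hmball)).symm.trans ?_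
  refine integral_congr_ae (Eventually.of_forall fun s => ?_)
  simpa using re_ofReal_cpow_add_I_mul (omegaKernel_smul_coe_sphere_pos hρ s hmball) (k / 2) b

end IsNormalizedRadialEigenfunction

theorem mainTheorem8 (k : ℕ) (hk : 1 ≤ k) (ρ : ℝ) (hρ : 0 < ρ) (κ : ℝ) (hκ : κ = -1 / ρ ^ 2)
    (lam : ℝ) :
    -- the normalized radial eigenfunction exists and is unique
    (∃ φ : ℝ → ℂ, IsNormalizedRadialEigenfunction k ρ lam φ ∧
      ∀ ψ : ℝ → ℂ, IsNormalizedRadialEigenfunction k ρ lam ψ → EqOn ψ φ (Ici 0)) ∧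
    ∀ φ : ℝ → ℂ, IsNormalizedRadialEigenfunction k ρ lam φ →
      -- it vanishes at a finite radius iff the eigenvalue exceeds the threshold
      ((∃ r : ℝ, 0 ≤ r ∧ φ r = 0) ↔ lam > -κ * (k : ℝ) ^ 2 / 4) ∧
      (lam > -κ * (k : ℝ) ^ 2 / 4 ↔
        ∃ (α : ℂ) (b : ℝ), (lam : ℂ) = (α * (k : ℂ) - α ^ 2) / (ρ : ℂ) ^ 2 ∧
          α = (k : ℂ) / 2 + Complex.I * (b : ℂ) ∧ b ≠ 0) ∧
      ((∃ r : ℝ, 0 ≤ r ∧ φ r = 0) →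
        -- it is real-valued and changes sign infinitely many times
        (∀ r : ℝ, 0 ≤ r → (φ r).im = 0) ∧
        (∀ R : ℝ, ∃ r₁ r₂ : ℝ, R < r₁ ∧ R < r₂ ∧ (φ r₁).re < 0 ∧ 0 < (φ r₂).re) ∧
        -- it vanishes at infinity
        Tendsto φ atTop (𝓝 0) ∧
        -- spacing of successive zeros
        (∃ T₁ T₂ Λ₀ : ℝ, 0 < T₁ ∧ 0 < T₂ ∧ 0 < Λ₀ ∧
          ∀ r₁ r₂ : ℝ, Λ₀ < r₁ → r₁ < r₂ → φ r₁ = 0 → φ r₂ = 0 →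
            (∀ r ∈ Ioo r₁ r₂, φ r ≠ 0) → T₁ < |r₂ - r₁| ∧ |r₂ - r₁| < T₂) ∧
        -- integral representations
        (∃ b : ℝ, b = Real.sqrt (lam / (-κ) - (k : ℝ) ^ 2 / 4) ∧ 0 < b ∧
          ∀ (u : Eucl k) (η : ℝ), ‖u‖ = ρ → 0 < η → η < ρ →
            φ (hyperbolicRadius ρ η) =
              sphereMean k η (fun m =>
                (omegaKernel u m : ℂ) ^ ((k : ℂ) / 2 + Complex.I * (b : ℂ))) ∧
            φ (hyperbolicRadius ρ η) =
              sphereMean k η (fun m =>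
                (omegaKernel u m : ℂ) ^ ((k : ℂ) / 2 - Complex.I * (b : ℂ))) ∧
            φ (hyperbolicRadius ρ η) =
              ((sphereMean k η (fun m =>
                omegaKernel u m ^ ((k : ℝ) / 2) *
                  Real.cos (Real.sqrt (lam / (-κ) - (k : ℝ) ^ 2 / 4) *
                    Real.log (omegaKernel u m))) : ℝ) : ℂ) ∧
            ∀ m : Eucl k, ‖m‖ = η →
              omegaKernel u m = (ρ ^ 2 - η ^ 2) / (ρ ^ 2 + η ^ 2 +
                2 * η * ρ * Real.cos (Real.pi - InnerProductGeometry.angle u m)))) := by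
  have hthreshold : -κ * (k : ℝ) ^ 2 / 4 = (k / ρ) ^ 2 / 4 := by
    rw [hκ]
    ring
  have hquot : lam / -κ = lam * ρ ^ 2 := by
    rw [hκ]
    field_simp
  rw [hthreshold, hquot]
  refine ⟨?_, fun φ h => ⟨h.exists_eq_zero_iff hk hρ, exists_exponent_iff hρ, fun hzero => ?_⟩⟩
  · obtain ⟨φ, h⟩ := exists_isNormalizedRadialEigenfunction hk hρ lam
    exact ⟨φ, h, fun ψ h' => h'.eqOn h hk hρ⟩
  have hlam : (k / ρ) ^ 2 / 4 < lam := (h.exists_eq_zero_iff hk hρ).1 hzero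
  have hdisc : 0 < lam * ρ ^ 2 - (k : ℝ) ^ 2 / 4 := sub_pos.2 ((sq_div_four_lt_iff hρ).1 hlam)
  have hb := (add_comm _ _).trans (eq_sub_iff_add_eq.1 (Real.sq_sqrt hdisc.le))
  refine ⟨fun _ => h.im_eq_zero hk hρ, h.exists_sign_changes hk hρ hlam,
    h.tendsto_atTop_zero hk hρ (hlam.trans_le' (by positivity)),
    h.exists_zero_spacing hk hρ hlam, _, rfl, Real.sqrt_pos.2 hdisc, fun u η hu hη hηρ =>
      ⟨h.eq_sphereMean_add_I_mul hk hρ hb ⟨hη, hηρ⟩ hu,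
        h.eq_sphereMean_sub_I_mul hk hρ hb ⟨hη, hηρ⟩ hu,
        h.eq_sphereMean_cos hk hρ hb ⟨hη, hηρ⟩ hu, fun m hm => ?_⟩⟩
  rw [omegaKernel_eq_cos_angle, hu, hm]
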